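/- Let $X$ be a connected simple graph on an arbitrary vertex set $VX$ (not assumed locally finite), and let $N$ be a network based on $X$, i.e. $X$ together with a capacity $c : EX \to \{1,2,\dots\}$. For $A\subseteq VX$ write $A^*=VX\setminus A$, and let $\delta A$ be the set of edges with one vertex in $A$ and one in $A^*$. A \emph{cut} is a set $A\subseteq VX$ with $\delta A$ finite; its capacity is $c(A)=\sum_{e\in\delta A}c(e)$. A ray is a sequence of distinct vertices in which consecutive ones are adjacent; a cut separates two rays if one ray is eventually in $A$ and the other eventually in $A^*$. Two rays are equivalent if no cut separates them, and $\Omega X$ is the set of equivalence classes, the (edge) ends of $X$. A vertex lies in $A$ if it is an element of $A$; an end lies in $A$ if every ray representing it is eventually in $A$. A cut $A$ separates $x,y\in VX\cup\Omega X$ if one of them lies in $A$ and the other lies in $A^*$. For $s,t\in VX\cup\Omega X$, an $(s,t)$-flow is a map $f:EX\to\{0,1,2,\dots\}$ together with a direction of each edge $e$ with $f(e)\ne 0$, from $\iota e$ to $\tau e$, such that (i) $f(e)\le c(e)$ for every edge $e$; (ii) each vertex is incident with only finitely many edges $e$ with $f(e)\neq 0$; (iii) $\sum_{\iota e=v}f(e)=\sum_{\tau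 e=v}f(e)$ for every vertex $v\ne s,t$ that can be separated by a cut from each of those of $s,t$ that are ends (which is the case for every vertex of finite degree); (iv) $f^+(A)=f^-(A)$ for every cut $A$ that does not separate $s$ and $t$, where $f^+(A)$ and $f^-(A)$ are the sums of $f(e)$ over the edges $e\in\delta A$ with $\iota e\in A$ and with $\iota e\in A^*$, respectively. For a cut $A$ with $s$ in $A$ and $t$ in $A^*$ the number $f^+(A)-f^-(A)$ does not depend on $A$; it is the value $|f|$ of the flow. \textbf{Theorem (MFMC).} Let $s,t\in VX\cup\Omega X$ be separated by at least one cut. Then the maximum value of an $(s,t)$-flow exists and equals the minimal capacity of a cut separating $s$ and $t$. -/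

import Mathlib

open Filter

universe u

/-- A network: a connected simple graph on an arbitrary vertex set, not assumed locally finite,
with a positive integer capacity on every edge. -/
structure Network (V : Type u) where
  graph : SimpleGraph V
  connected : graph.Connected
  cap : graph.edgeSet → ℕ
  cap_pos : ∀ e, 1 ≤ cap e

namespace Network

variable {V : Type u}

/-- The edge boundary of `A`: the edges with one vertex in `A` and one outside `A`. -/
def boundary (N : Network V) (A : Set V) : Set N.graph.edgeSet :=
  {e | ∃ u ∈ A, ∃ v ∉ A, (e : Sym2 V) = s(u, v)}

/-- `A` is an (edge) cut: its edge boundary is finite. -/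
def IsCut (N : Network V) (A : Set V) : Prop := (N.boundary A).Finite

/-- The capacity of a cut: the sum of the capacities of the (finitely many) boundary edges. -/
noncomputable def cutCap (N : Network V) (A : Set V) : ℕ := ∑ᶠ e ∈ N.boundary A, N.cap e

/-- A ray: an infinite sequence of distinct vertices, consecutive ones being adjacent. -/
structure Ray (N : Network V) where
  vert : ℕ → V
  injective : Function.Injective vert
  adj : ∀ n, N.graph.Adj (vert n) (vert (n + 1))

/-- `A` separates the rays `R`, `R'`. -/
def SeparatesRays (N : Network V) (A : Set V) (R R' : N.Ray) : Prop :=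
  (∀ᶠ n in atTop, R.vert n ∈ A ∧ R'.vert n ∈ Aᶜ) ∨
    (∀ᶠ n in atTop, R.vert n ∈ Aᶜ ∧ R'.vert n ∈ A)

/-- A ray is eventually on one side of any given cut. -/
theorem Ray.eventually_mem_or (N : Network V) {A : Set V} (hA : N.IsCut A) (R : N.Ray) :
    (∀ᶠ n in atTop, R.vert n ∈ A) ∨ (∀ᶠ n in atTop, R.vert n ∈ Aᶜ) := by
  let E : ℕ → N.graph.edgeSet := fun n => ⟨s(R.vert n, R.vert (n + 1)), R.adj n⟩
  have hE : Function.Injective E := by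
    intro m n h
    have h' : s(R.vert m, R.vert (m + 1)) = s(R.vert n, R.vert (n + 1)) := congrArg Subtype.val h
    rw [Sym2.eq_iff] at h'
    rcases h' with ⟨h1, _⟩ | ⟨h1, h2⟩
    · exact R.injective h1
    · have := R.injective h1
      have := R.injective h2
      omega
  have hfin : {n | E n ∈ N.boundary A}.Finite := Set.Finite.preimage hE.injOn hA
  obtain ⟨M, hM⟩ := hfin.bddAbove
  have step : ∀ n, M + 1 ≤ n → (R.vert n ∈ A ↔ R.vert (n + 1) ∈ A) := by
    intro n hn
    have hnot : E n ∉ N.boundary A := fun h => by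
      have := hM h
      omega
    constructor
    · intro h
      by_contra h'
      exact hnot ⟨_, h, _, h', rfl⟩
    · intro h
      by_contra h'
      exact hnot ⟨_, h, _, h', Sym2.eq_swap⟩
  have all : ∀ n, M + 1 ≤ n → (R.vert n ∈ A ↔ R.vert (M + 1) ∈ A) := by
    intro n hn
    induction n, hn using Nat.le_induction with
    | base => rfl
    | succ k hk ih => rw [← step k hk, ih]
  by_cases h : R.vert (M + 1) ∈ A
  · left
    filter_upwards [eventually_ge_atTop (M + 1)] with n hn using (all n hn).2 h
  · right
    filter_upwards [eventually_ge_atTop (M + 1)] with n hn using fun h' => h ((all n hn).1 h')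

/-- Two rays are equivalent if no cut separates them. -/
def raySetoid (N : Network V) : Setoid N.Ray where
  r R R' := ¬ ∃ A, N.IsCut A ∧ N.SeparatesRays A R R'
  iseqv := by
    refine ⟨?_, ?_, ?_⟩
    · rintro R ⟨A, _, h | h⟩
      · obtain ⟨n, hn⟩ := h.exists
        exact hn.2 hn.1
      · obtain ⟨n, hn⟩ := h.exists
        exact hn.1 hn.2
    · rintro R R' h ⟨A, hA, h' | h'⟩
      · exact h ⟨A, hA, Or.inr (h'.mono fun n hn => hn.symm)⟩
      · exact h ⟨A, hA, Or.inl (h'.mono fun n hn => hn.symm)⟩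
    · rintro R R' R'' h₁ h₂ ⟨A, hA, h | h⟩
      · rcases Ray.eventually_mem_or N hA R' with h' | h'
        · exact h₂ ⟨A, hA, Or.inl (by filter_upwards [h, h'] with n a b using ⟨b, a.2⟩)⟩
        · exact h₁ ⟨A, hA, Or.inl (by filter_upwards [h, h'] with n a b using ⟨a.1, b⟩)⟩
      · rcases Ray.eventually_mem_or N hA R' with h' | h'
        · exact h₁ ⟨A, hA, Or.inr (by filter_upwards [h, h'] with n a b using ⟨a.1, b⟩)⟩
        · exact h₂ ⟨A, hA, Or.inr (by filter_upwards [h, h'] with n a b using ⟨b, a.2⟩)⟩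

/-- The edge ends of the underlying graph. -/
def End (N : Network V) : Type u := Quotient N.raySetoid

/-- The end to which a ray belongs. -/
def Ray.toEnd {N : Network V} (R : N.Ray) : N.End := Quotient.mk N.raySetoid R

/-- `N.Point` is the disjoint union of the set of vertices and the set of edge ends. -/
abbrev Point (N : Network V) : Type u := V ⊕ N.End

/-- A vertex lies in `A` if it is an element of `A`; an end lies in `A` if every ray that
represents it is eventually in `A`. -/
def LiesIn (N : Network V) (A : Set V) : N.Point → Prop
  | Sum.inl v => v ∈ A
  | Sum.inr ω => ∀ R : N.Ray, R.toEnd = ω → ∀ᶠ n in atTop, R.vert n ∈ A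

/-- `A` separates `x` and `y`, each of them a vertex or an end. -/
def Separates (N : Network V) (A : Set V) (x y : N.Point) : Prop :=
  (N.LiesIn A x ∧ N.LiesIn Aᶜ y) ∨ (N.LiesIn Aᶜ x ∧ N.LiesIn A y)

/-- Some cut separates `x` and `y`. -/
def Separable (N : Network V) (x y : N.Point) : Prop :=
  ∃ A, N.IsCut A ∧ N.Separates A x y

/-- A nonnegative integer on every edge together with a direction of every edge. (The direction
of an edge with the value `0` plays no role.) -/
structure DirectedAssignment (N : Network V) where
  val : N.graph.edgeSet → ℕ
  dir : N.graph.edgeSet → N.graph.Dart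
  dir_edge : ∀ e, (dir e).edge = e

namespace DirectedAssignment

variable {N : Network V}

/-- The initial vertex of an edge. -/
def init (f : N.DirectedAssignment) (e : N.graph.edgeSet) : V := (f.dir e).fst

/-- The terminal vertex of an edge. -/
def term (f : N.DirectedAssignment) (e : N.graph.edgeSet) : V := (f.dir e).snd

/-- The flow out of the vertex `v`. -/
noncomputable def outAt (f : N.DirectedAssignment) (v : V) : ℕ :=
  ∑ᶠ e ∈ {e | f.init e = v}, f.val e

/-- The flow into the vertex `v`. -/
noncomputable def inAt (f : N.DirectedAssignment) (v : V) : ℕ :=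
  ∑ᶠ e ∈ {e | f.term e = v}, f.val e

/-- The flow out of `A`. -/
noncomputable def outOf (f : N.DirectedAssignment) (A : Set V) : ℕ :=
  ∑ᶠ e ∈ {e | e ∈ N.boundary A ∧ f.init e ∈ A}, f.val e

/-- The flow into `A`. -/
noncomputable def inTo (f : N.DirectedAssignment) (A : Set V) : ℕ :=
  ∑ᶠ e ∈ {e | e ∈ N.boundary A ∧ f.init e ∈ Aᶜ}, f.val e

/-- The net flow out of `A`. -/
noncomputable def net (f : N.DirectedAssignment) (A : Set V) : ℤ :=
  (f.outOf A : ℤ) - (f.inTo A : ℤ)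

end DirectedAssignment

/-- An `(s, t)`-flow. The last premise of `conserved_vertex` concerns only those of `s`, `t` that
are ends, and only vertices of infinite degree can violate it. -/
structure Flow (N : Network V) (s t : N.Point) extends DirectedAssignment N where
  le_cap : ∀ e, val e ≤ N.cap e
  finite_at : ∀ v : V, {e : N.graph.edgeSet | v ∈ (e : Sym2 V) ∧ val e ≠ 0}.Finite
  conserved_vertex : ∀ v : V, Sum.inl v ≠ s → Sum.inl v ≠ t →
    (∀ ω : N.End, Sum.inr ω = s ∨ Sum.inr ω = t → N.Separable (Sum.inl v) (Sum.inr ω)) →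
    toDirectedAssignment.outAt v = toDirectedAssignment.inAt v
  conserved_cut : ∀ A : Set V, N.IsCut A → ¬ N.Separates A s t →
    toDirectedAssignment.outOf A = toDirectedAssignment.inTo A

section Value

variable {N : Network V}

theorem LiesIn.mono {A B : Set V} (h : A ⊆ B) {x : N.Point} (hx : N.LiesIn A x) :
    N.LiesIn B x := by
  cases x with
  | inl v => exact h hx
  | inr ω => exact fun R hR => (hx R hR).mono fun n hn => h hn

theorem LiesIn.inter {A B : Set V} {x : N.Point} (hA : N.LiesIn A x) (hB : N.LiesIn B x) :
    N.LiesIn (A ∩ B) x := by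
  cases x with
  | inl v => exact ⟨hA, hB⟩
  | inr ω => exact fun R hR => (hA R hR).and (hB R hR)

theorem LiesIn.not_compl {A : Set V} {x : N.Point} (hA : N.LiesIn A x) : ¬ N.LiesIn Aᶜ x := by
  intro hB
  cases x with
  | inl v => exact hB hA
  | inr ω =>
    obtain ⟨R, hR⟩ := Quotient.exists_rep ω
    obtain ⟨n, h₁, h₂⟩ := ((hA R hR).and (hB R hR)).exists
    exact h₂ h₁

theorem mem_boundary_iff (f : N.DirectedAssignment) (A : Set V) (e : N.graph.edgeSet) :
    e ∈ N.boundary A ↔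
      (f.init e ∈ A ∧ f.term e ∉ A) ∨ (f.init e ∉ A ∧ f.term e ∈ A) := by
  have he : (e : Sym2 V) = s(f.init e, f.term e) := (f.dir_edge e).symm
  constructor
  · rintro ⟨u, hu, v, hv, h⟩
    rw [he, Sym2.eq_iff] at h
    rcases h with ⟨h₁, h₂⟩ | ⟨h₁, h₂⟩
    · left
      rw [h₁, h₂]
      exact ⟨hu, hv⟩
    · right
      rw [h₁, h₂]
      exact ⟨hv, hu⟩
  · rintro (⟨h₁, h₂⟩ | ⟨h₁, h₂⟩)
    · exact ⟨_, h₁, _, h₂, he⟩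
    · exact ⟨_, h₂, _, h₁, he.trans Sym2.eq_swap⟩

open Classical in
theorem net_eq (f : N.DirectedAssignment) {A : Set V} (F : Finset N.graph.edgeSet)
    (hF : N.boundary A ⊆ F) :
    f.net A = ∑ e ∈ F, (f.val e : ℤ) *
      ((if f.init e ∈ A then 1 else 0) - (if f.term e ∈ A then 1 else 0)) := by
  have h₁ : f.outOf A = ∑ e ∈ F, if e ∈ N.boundary A ∧ f.init e ∈ A then f.val e else 0 := by
    rw [← Finset.sum_filter]
    refine finsum_mem_eq_sum_of_inter_support_eq _ ?_
    ext e
    simp only [Set.mem_inter_iff, Set.mem_ofPred_eq, Finset.coe_filter]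
    exact ⟨fun h => ⟨⟨hF h.1.1, h.1⟩, h.2⟩, fun h => ⟨h.1.2, h.2⟩⟩
  have h₂ : f.inTo A = ∑ e ∈ F, if e ∈ N.boundary A ∧ f.init e ∈ Aᶜ then f.val e else 0 := by
    rw [← Finset.sum_filter]
    refine finsum_mem_eq_sum_of_inter_support_eq _ ?_
    ext e
    simp only [Set.mem_inter_iff, Set.mem_ofPred_eq, Finset.coe_filter]
    exact ⟨fun h => ⟨⟨hF h.1.1, h.1⟩, h.2⟩, fun h => ⟨h.1.2, h.2⟩⟩
  rw [DirectedAssignment.net, h₁, h₂, Nat.cast_sum, Nat.cast_sum, ← Finset.sum_sub_distrib]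
  refine Finset.sum_congr rfl fun e _ => ?_
  have := mem_boundary_iff f A e
  by_cases a : f.init e ∈ A <;> by_cases b : f.term e ∈ A <;> simp_all

theorem IsCut.inter {A B : Set V} (hA : N.IsCut A) (hB : N.IsCut B) : N.IsCut (A ∩ B) := by
  refine (Set.Finite.union hA hB).subset ?_
  rintro e ⟨u, hu, v, hv, h⟩
  by_cases hv' : v ∈ A
  · exact Or.inr ⟨u, hu.2, v, fun h' => hv ⟨hv', h'⟩, h⟩
  · exact Or.inl ⟨u, hu.1, v, hv', h⟩

theorem IsCut.compl {A : Set V} (hA : N.IsCut A) : N.IsCut Aᶜ := by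
  refine Set.Finite.subset hA ?_
  rintro e ⟨u, hu, v, hv, h⟩
  exact ⟨v, not_not.1 hv, u, hu, h.trans Sym2.eq_swap⟩

theorem Flow.net_eq_of_subset {s t : N.Point} (f : N.Flow s t) {A B : Set V} (hA : N.IsCut A)
    (hB : N.IsCut B) (hsA : N.LiesIn A s) (htB : N.LiesIn Bᶜ t) (hAB : A ⊆ B) :
    f.net A = f.net B := by
  classical
  have hD : N.IsCut (B \ A) := hB.inter hA.compl
  have hsep : ¬ N.Separates (B \ A) s t := by
    rintro (⟨h, _⟩ | ⟨_, h⟩)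
    · have hsub : A ⊆ (B \ A)ᶜ := fun x hx hx' => hx'.2 hx
      exact h.not_compl (hsA.mono hsub)
    · have hsub : Bᶜ ⊆ (B \ A)ᶜ := Set.compl_subset_compl.2 Set.sdiff_subset
      exact h.not_compl (htB.mono hsub)
  have h0 : f.net (B \ A) = 0 := by
    rw [DirectedAssignment.net, f.conserved_cut _ hD hsep, sub_self]
  have hfin := (Set.Finite.union hA hB).union hD
  have hsub : ∀ C : Set V, N.boundary C ⊆ N.boundary A ∪ N.boundary B ∪ N.boundary (B \ A) →
      N.boundary C ⊆ (hfin.toFinset : Set N.graph.edgeSet) := by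
    intro C hC
    rwa [Set.Finite.coe_toFinset]
  rw [net_eq _ hfin.toFinset (hsub _ fun e he => Or.inr he)] at h0
  rw [net_eq _ hfin.toFinset (hsub A fun e he => Or.inl (Or.inl he)),
    net_eq _ hfin.toFinset (hsub B fun e he => Or.inl (Or.inr he)), eq_comm, ← sub_eq_zero,
    ← Finset.sum_sub_distrib, ← h0]
  refine Finset.sum_congr rfl fun e _ => ?_
  rw [← mul_sub]
  congr 1
  have h₁ := @hAB (f.init e)
  have h₂ := @hAB (f.term e)
  by_cases a : f.init e ∈ A <;> by_cases b : f.term e ∈ A <;>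
    by_cases c : f.init e ∈ B <;> by_cases d : f.term e ∈ B <;> simp_all

/-- The net flow across a cut `A` with `s` in `A` and `t` in the complement of `A` does not depend
on `A`. -/
theorem Flow.net_eq_net {s t : N.Point} (f : N.Flow s t) {A B : Set V}
    (hA : N.IsCut A) (hsA : N.LiesIn A s) (htA : N.LiesIn Aᶜ t)
    (hB : N.IsCut B) (hsB : N.LiesIn B s) (htB : N.LiesIn Bᶜ t) : f.net A = f.net B := by
  have hAB := hA.inter hB
  have hs := hsA.inter hsB
  rw [← f.net_eq_of_subset hAB hA hs htA Set.inter_subset_left,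
    ← f.net_eq_of_subset hAB hB hs htB Set.inter_subset_right]

open Classical in
/-- The value of a flow: the net flow out of `A` for any cut `A` with `s` in `A` and `t` in the
complement of `A`; it is meaningful only if there is such a cut. -/
noncomputable def Flow.value {s t : N.Point} (f : N.Flow s t) : ℤ :=
  if h : ∃ A, N.IsCut A ∧ N.LiesIn A s ∧ N.LiesIn Aᶜ t then f.net h.choose else 0

theorem Flow.value_eq {s t : N.Point} (f : N.Flow s t) {A : Set V}
    (hA : N.IsCut A) (hsA : N.LiesIn A s) (htA : N.LiesIn Aᶜ t) : f.value = f.net A := by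
  have h : ∃ A, N.IsCut A ∧ N.LiesIn A s ∧ N.LiesIn Aᶜ t := ⟨A, hA, hsA, htA⟩
  rw [Flow.value, dif_pos h]
  exact f.net_eq_net h.choose_spec.1 h.choose_spec.2.1 h.choose_spec.2.2 hA hsA htA

end Value

end Network

/-! A flow has net value at most the capacity of any separating cut, and a minimal cut exists
because capacities are natural numbers. It remains to saturate a minimal cut `A` with `s` in `A` and
`t` in `Aᶜ`. Flows are handled as antisymmetric integer functions on pairs of vertices, bounded by
`pairCap`.

The problem splits along `A`: it suffices to have, on either side, a half flow that enters the side
at full capacity and ends at its terminal (`IsHalfFlow`). One is reversed, and the two agree on the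
boundary, where both are saturated (`exists_flow_of_min_cut`).

The finite tool is Ford–Fulkerson for flows of finite support on a possibly infinite vertex set.
Values are integers bounded by the capacity of the source set, so a maximum exists, and the set
reachable in the residual graph is then saturated (`exists_saturated_set`,
`exists_saturating_flow`).

If the terminal is a vertex, or an end that no cut separates from some vertex `v₀`, a finite flow to
`v₀` is a half flow. Otherwise the end is surrounded by nested minimal cuts `K 0 ⊇ K 1 ⊇ ...` with
empty intersection (`IsMinCutAt.exists_inner`). Finite flows from one cut to the next, each
continuing the boundary values of the preceding one (`IsMinCutAt.exists_flow_between`), are glued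
level by level. Minimality of the `K i` serves twice: it makes the flows exist, and it forces every
cut that excludes the end to miss some `K i`. The conservation law for a cut thereby reduces to a
finite sum. -/

namespace Network

/-! ### Antisymmetric functions on pairs of vertices -/

section PairFlow

variable {V : Type u}

/-- The total of `g` over the pairs that lead from `B` to its complement. -/
noncomputable def crossSum (g : V → V → ℤ) (B : Set V) : ℤ := ∑ᶠ p ∈ B ×ˢ Bᶜ, g p.1 p.2

/-- The total of `g` over the pairs that start at `u`. -/
noncomputable def rowSum (g : V → V → ℤ) (u : V) : ℤ := ∑ᶠ v, g u v

/-- Swapping coordinates turns the sum into its negative. No finiteness is needed, since a `finsum`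
of infinite support is `0` by default. -/
theorem finsum_mem_prod_self_eq_zero {g : V → V → ℤ} (hg : ∀ u v, g u v = -g v u) (B : Set V) :
    ∑ᶠ p ∈ B ×ˢ B, g p.1 p.2 = 0 := by
  have h : ∑ᶠ p ∈ B ×ˢ B, g p.1 p.2 = ∑ᶠ p ∈ B ×ˢ B, -g p.1 p.2 := by
    refine finsum_mem_eq_of_bijOn Prod.swap ⟨?_, Prod.swap_injective.injOn, ?_⟩ ?_
    · exact fun p hp => ⟨hp.2, hp.1⟩
    · exact fun p hp => ⟨p.swap, ⟨hp.2, hp.1⟩, Prod.swap_swap p⟩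
    · exact fun p _ => hg p.1 p.2
  have h' : ∑ᶠ p ∈ B ×ˢ B, -g p.1 p.2 = -∑ᶠ p ∈ B ×ˢ B, g p.1 p.2 := by
    simp only [← finsum_neg_distrib]
  omega

/-- Summation by parts for an antisymmetric function. -/
theorem crossSum_eq_finsum_rowSum {g : V → V → ℤ} (hg : ∀ u v, g u v = -g v u) {B : Set V}
    (hfin : {p : V × V | p.1 ∈ B ∧ g p.1 p.2 ≠ 0}.Finite) :
    crossSum g B = ∑ᶠ u ∈ B, rowSum g u := by
  classical
  have h1 : ∑ᶠ p ∈ B ×ˢ (Set.univ : Set V), g p.1 p.2 = ∑ᶠ u ∈ B, rowSum g u := by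
    rw [finsum_mem_def, finsum_mem_def, finsum_curry]
    · refine finsum_congr fun u => ?_
      by_cases hu : u ∈ B <;> simp [Set.indicator, hu, rowSum]
    · refine hfin.subset fun p hp => ?_
      simp only [Function.mem_support, Set.indicator_apply_ne_zero] at hp
      exact ⟨hp.1.1, hp.2⟩
  have hsplit : B ×ˢ (Set.univ : Set V) = B ×ˢ Bᶜ ∪ B ×ˢ B := by
    rw [← Set.prod_union, Set.compl_union_self]
  rw [hsplit, finsum_mem_union', finsum_mem_prod_self_eq_zero hg, add_zero] at h1
  · exact h1
  · exact Set.disjoint_left.2 fun p hp hp' => hp.2 hp'.2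
  · exact hfin.subset fun p hp => ⟨hp.1.1, hp.2⟩
  · exact hfin.subset fun p hp => ⟨hp.1.1, hp.2⟩

theorem crossSum_eq_zero {g : V → V → ℤ} (hg : ∀ u v, g u v = -g v u) {B : Set V}
    (hfin : {p : V × V | p.1 ∈ B ∧ g p.1 p.2 ≠ 0}.Finite) (h0 : ∀ u ∈ B, rowSum g u = 0) :
    crossSum g B = 0 := by
  rw [crossSum_eq_finsum_rowSum hg hfin]
  exact finsum_mem_eq_zero_of_forall_eq_zero h0

theorem crossSum_compl {g : V → V → ℤ} (hg : ∀ u v, g u v = -g v u) (B : Set V) :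
    crossSum g Bᶜ = -crossSum g B := by
  rw [crossSum, crossSum, ← finsum_neg_distrib]
  simp only [← finsum_neg_distrib]
  refine finsum_mem_eq_of_bijOn Prod.swap ⟨?_, Prod.swap_injective.injOn, ?_⟩ ?_
  · exact fun p hp => ⟨not_not.1 hp.2, hp.1⟩
  · exact fun p hp => ⟨p.swap, ⟨hp.2, not_not.2 hp.1⟩, Prod.swap_swap p⟩
  · exact fun p _ => hg p.1 p.2

theorem crossSum_congr {g g' : V → V → ℤ} {B : Set V} (h : ∀ u ∈ B, ∀ v ∉ B, g u v = g' u v) :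
    crossSum g B = crossSum g' B :=
  finsum_mem_congr rfl fun p hp => h p.1 hp.1 p.2 hp.2

theorem crossSum_le_crossSum {g w : V → V → ℤ} (B : Set V)
    (hg : {p : V × V | p ∈ B ×ˢ Bᶜ ∧ g p.1 p.2 ≠ 0}.Finite)
    (hw : {p : V × V | p ∈ B ×ˢ Bᶜ ∧ w p.1 p.2 ≠ 0}.Finite)
    (h : ∀ u ∈ B, ∀ v ∉ B, g u v ≤ w u v) : crossSum g B ≤ crossSum w B := by
  have hF := hg.union hw
  have key : ∀ f : V → V → ℤ, {p : V × V | p ∈ B ×ˢ Bᶜ ∧ f p.1 p.2 ≠ 0} ⊆ hF.toFinset →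
      crossSum f B = ∑ p ∈ hF.toFinset, f p.1 p.2 := by
    intro f hf
    refine finsum_mem_eq_sum_of_inter_support_eq _ ?_
    ext p
    simp only [Set.mem_inter_iff, Function.mem_support, ne_eq, SetLike.mem_coe,
      Set.Finite.mem_toFinset, Set.mem_union, Set.mem_ofPred_eq]
    constructor
    · exact fun hp => ⟨(Set.Finite.mem_toFinset hF).1 (hf hp), hp.2⟩
    · rintro ⟨hp | hp, hp'⟩
      · exact ⟨hp.1, hp'⟩
      · exact ⟨hp.1, hp'⟩
  rw [key g (by simp), key w (by simp)]
  refine Finset.sum_le_sum fun p hp => ?_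
  rw [Set.Finite.mem_toFinset] at hp
  rcases hp with hp | hp <;> exact h _ hp.1.1 _ hp.1.2

theorem crossSum_add {g g' : V → V → ℤ} (B : Set V)
    (hg : {p : V × V | p ∈ B ×ˢ Bᶜ ∧ g p.1 p.2 ≠ 0}.Finite)
    (hg' : {p : V × V | p ∈ B ×ˢ Bᶜ ∧ g' p.1 p.2 ≠ 0}.Finite) :
    crossSum (fun u v => g u v + g' u v) B = crossSum g B + crossSum g' B :=
  finsum_mem_add_distrib' hg hg'

/-- A function dominated by `w` from `B` to its complement whose total is no less agrees with `w`
there. -/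
theorem eq_of_crossSum_le {g w : V → V → ℤ} (B : Set V)
    (hg : {p : V × V | p ∈ B ×ˢ Bᶜ ∧ g p.1 p.2 ≠ 0}.Finite)
    (hw : {p : V × V | p ∈ B ×ˢ Bᶜ ∧ w p.1 p.2 ≠ 0}.Finite)
    (h : ∀ u ∈ B, ∀ v ∉ B, g u v ≤ w u v) (hle : crossSum w B ≤ crossSum g B) :
    ∀ u ∈ B, ∀ v ∉ B, g u v = w u v := by
  classical
  intro u hu v hv
  by_contra hne
  have hlt : g u v < w u v := lt_of_le_of_ne (h u hu v hv) hne
  -- By integrality there is room for one more unit at `(u, v)`: `g + e` is still dominated by `w`,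
  -- but its total exceeds that of `w`.
  let e : V → V → ℤ := fun a b => if a = u ∧ b = v then 1 else 0
  have he : {p : V × V | p ∈ B ×ˢ Bᶜ ∧ e p.1 p.2 ≠ 0}.Finite := by
    refine (Set.finite_singleton (u, v)).subset fun p hp => ?_
    have : p.1 = u ∧ p.2 = v := by
      by_contra hcon
      exact hp.2 (if_neg hcon)
    exact Prod.ext this.1 this.2
  have h1 : crossSum e B = 1 := by
    have : crossSum e B = ∑ p ∈ {(u, v)}, e p.1 p.2 := by
      refine finsum_mem_eq_sum_of_inter_support_eq _ ?_
      ext p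
      simp only [Set.mem_inter_iff, Function.mem_support, e, Finset.coe_singleton,
        Set.mem_singleton_iff]
      constructor
      · rintro ⟨_, hp⟩
        simp only [ne_eq, ite_eq_right_iff, one_ne_zero, imp_false, not_not] at hp
        exact ⟨Prod.ext hp.1 hp.2, by simp [hp.1, hp.2]⟩
      · rintro ⟨rfl, hp⟩
        exact ⟨⟨hu, hv⟩, hp⟩
    rw [this, Finset.sum_singleton]
    exact if_pos ⟨rfl, rfl⟩
  have h2 := crossSum_add B hg he
  have h3 : crossSum (fun a b => g a b + e a b) B ≤ crossSum w B := by
    refine crossSum_le_crossSum B ((hg.union he).subset ?_) hw ?_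
    · rintro p ⟨hp, hp'⟩
      by_cases h0 : g p.1 p.2 = 0
      · exact Or.inr ⟨hp, by simpa [h0] using hp'⟩
      · exact Or.inl ⟨hp, h0⟩
    · intro a ha b hb
      by_cases hab : a = u ∧ b = v
      · simp only [e, if_pos hab]
        rw [hab.1, hab.2]
        omega
      · simpa [e, hab] using h a ha b hb
  omega

theorem rowSum_add {g h : V → V → ℤ} (u : V) (hg : {v | g u v ≠ 0}.Finite)
    (hh : {v | h u v ≠ 0}.Finite) : rowSum (fun u v => g u v + h u v) u = rowSum g u + rowSum h u :=
  finsum_add_distrib hg hh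

theorem finite_row {g : V → V → ℤ} (hg : {p : V × V | g p.1 p.2 ≠ 0}.Finite) (u : V) :
    {v | g u v ≠ 0}.Finite :=
  hg.preimage (f := fun v => (u, v)) (Prod.mk_right_injective u).injOn

end PairFlow

/-! ### Ford–Fulkerson for flows of finite support -/

section FordFulkerson

variable {V : Type u}

/-- The vertices that can be reached from `S` by at most `n` steps of the relation `r`. -/
def reach (r : V → V → Prop) (S : Set V) : ℕ → Set V
  | 0 => S
  | n + 1 => reach r S n ∪ {v | ∃ u ∈ reach r S n, r u v}

/-- A unit flow from `S` to a vertex that can be reached from `S`, along steps of `r`. -/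
theorem exists_unit_flow (r : V → V → Prop) (S : Set V) (n : ℕ) :
    ∀ b ∈ reach r S n, ∃ a ∈ S, ∃ h : V → V → ℤ, (∀ u v, h u v = -h v u) ∧
      {p : V × V | h p.1 p.2 ≠ 0}.Finite ∧ (∀ u v, h u v ≤ 1) ∧ (∀ u v, 0 < h u v → r u v) ∧
      (∀ u v, h u v ≠ 0 → v ∈ reach r S n) ∧
      ∀ u, rowSum h u = (Set.indicator {a} 1 u : ℤ) - Set.indicator {b} 1 u := by
  classical
  induction n with
  | zero =>
    intro b hb
    exact ⟨b, hb, fun _ _ => 0, by simp, by simp, by simp, by simp, by simp, by simp [rowSum]⟩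
  | succ n ih =>
    intro b hb
    by_cases hbn : b ∈ reach r S n
    · obtain ⟨a, ha, h, h1, h2, h3, h4, h5, h6⟩ := ih b hbn
      exact ⟨a, ha, h, h1, h2, h3, h4, fun u v huv => Or.inl (h5 u v huv), h6⟩
    · obtain ⟨c, hc, hcb⟩ : ∃ c ∈ reach r S n, r c b := hb.resolve_left hbn
      obtain ⟨a, ha, h, h1, h2, h3, h4, h5, h6⟩ := ih c hc
      have hne : c ≠ b := fun hcb' => hbn (hcb' ▸ hc)
      -- The flow to `c` lives on vertices reached within `n` steps, so it does not touch the new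
      -- vertex `b`. Adding the step from `c` to `b` therefore cannot exceed one unit on any pair.
      have hz : ∀ u, h u b = 0 := fun u => by
        by_contra hu
        exact hbn (h5 u b hu)
      have hz' : ∀ u, h b u = 0 := fun u => by rw [h1, hz, neg_zero]
      let e : V → V → ℤ := fun u v =>
        if u = c ∧ v = b then 1 else if u = b ∧ v = c then -1 else 0
      have hecb : e c b = 1 := if_pos ⟨rfl, rfl⟩
      have hebc : e b c = -1 := by simp [e, hne]
      have he0 : ∀ u v, ¬ (u = c ∧ v = b) → ¬ (u = b ∧ v = c) → e u v = 0 := fun u v h h' => by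
        simp only [e, if_neg h, if_neg h']
      have hcases : ∀ u v, (u = c ∧ v = b) ∨ (u = b ∧ v = c) ∨
          (e u v = 0) := fun u v => by
        by_cases h : u = c ∧ v = b
        · exact Or.inl h
        · by_cases h' : u = b ∧ v = c
          · exact Or.inr (Or.inl h')
          · exact Or.inr (Or.inr (he0 u v h h'))
      have hefin : {p : V × V | e p.1 p.2 ≠ 0}.Finite := by
        refine (Set.toFinite {(c, b), (b, c)}).subset fun p hp => ?_
        rcases hcases p.1 p.2 with h | h | h
        · exact Or.inl (Prod.ext h.1 h.2)
        · exact Or.inr (Prod.ext h.1 h.2)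
        · exact absurd h hp
      have herow : ∀ u, rowSum e u = (Set.indicator {c} 1 u : ℤ) - Set.indicator {b} 1 u := by
        intro u
        by_cases hu : u = c
        · subst hu
          rw [rowSum, finsum_eq_single _ b fun v hv => he0 u v (fun h => hv h.2)
            (fun h => hne h.1), hecb]
          simp [hne]
        · by_cases hub : u = b
          · subst hub
            rw [rowSum, finsum_eq_single _ c fun v hv => he0 u v (fun h => hu h.1)
              (fun h => hv h.2), hebc]
            simp [hu]
          · rw [rowSum, finsum_eq_zero_of_forall_eq_zero fun v => he0 u v (fun h => hu h.1)
              (fun h => hub h.1)]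
            simp [hu, hub]
      refine ⟨a, ha, fun u v => h u v + e u v, ?_, ?_, ?_, ?_, ?_, ?_⟩
      · intro u v
        have he : e u v = -e v u := by
          rcases hcases u v with ⟨rfl, rfl⟩ | ⟨rfl, rfl⟩ | h0
          · rw [hecb, hebc, neg_neg]
          · rw [hecb, hebc]
          · rcases hcases v u with ⟨rfl, rfl⟩ | ⟨rfl, rfl⟩ | h0'
            · rw [hecb, hebc]
            · rw [hecb, hebc, neg_neg]
            · rw [h0, h0', neg_zero]
        have := h1 u v
        dsimp only
        omega
      · refine (h2.union hefin).subset fun p hp => ?_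
        by_contra hcon
        simp only [Set.mem_union, Set.mem_ofPred_eq, not_or, not_not] at hcon
        exact hp (by simp [hcon.1, hcon.2])
      · intro u v
        dsimp only
        rcases hcases u v with ⟨rfl, rfl⟩ | ⟨rfl, rfl⟩ | h0
        · rw [hz, hecb, zero_add]
        · rw [hz', hebc]
          norm_num
        · rw [h0, add_zero]
          exact h3 u v
      · intro u v huv
        dsimp only at huv
        rcases hcases u v with ⟨rfl, rfl⟩ | ⟨rfl, rfl⟩ | h0
        · exact hcb
        · rw [hz', hebc] at huv
          omega
        · rw [h0, add_zero] at huv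
          exact h4 u v huv
      · intro u v huv
        dsimp only at huv
        rcases hcases u v with ⟨rfl, rfl⟩ | ⟨rfl, rfl⟩ | h0
        · exact hb
        · exact Or.inl hc
        · rw [h0, add_zero] at huv
          exact Or.inl (h5 u v huv)
      · intro u
        rw [rowSum_add u (finite_row h2 u) (finite_row hefin u), h6, herow]
        ring

/-- A flow of finite support from `S` to `T` for the directed capacities `w`. -/
structure IsFiniteFlow (w : V → V → ℤ) (S T : Set V) (g : V → V → ℤ) : Prop where
  antisymm : ∀ u v, g u v = -g v u
  le : ∀ u v, g u v ≤ w u v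
  finite : {p : V × V | g p.1 p.2 ≠ 0}.Finite
  conserved : ∀ u, u ∉ S → u ∉ T → rowSum g u = 0

/-- Summation by parts: the vertices of `B` outside `S` are conserved and contribute nothing. -/
theorem IsFiniteFlow.crossSum_eq {w : V → V → ℤ} {S T B : Set V} {g : V → V → ℤ}
    (hg : IsFiniteFlow w S T g) (hSB : S ⊆ B) (hBT : Disjoint B T) :
    crossSum g B = crossSum g S := by
  rw [crossSum_eq_finsum_rowSum hg.antisymm (hg.finite.subset fun p hp => hp.2),
    crossSum_eq_finsum_rowSum hg.antisymm (hg.finite.subset fun p hp => hp.2)]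
  refine finsum_mem_inter_support_eq' _ _ _ fun u hu => ⟨fun huB => ?_, fun huS => hSB huS⟩
  by_contra huS
  exact hu (hg.conserved u huS (Set.disjoint_left.1 hBT huB))

/-- A flow that cannot be augmented: it saturates all pairs that leave some set. -/
theorem exists_saturated_set (w : V → V → ℤ) (hw : ∀ u v, 0 ≤ w u v) {S T : Set V}
    (hST : Disjoint S T) (hS : {p : V × V | p ∈ S ×ˢ Sᶜ ∧ w p.1 p.2 ≠ 0}.Finite) :
    ∃ g B, IsFiniteFlow w S T g ∧ S ⊆ B ∧ Disjoint B T ∧ ∀ u ∈ B, ∀ v ∉ B, g u v = w u v := by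
  classical
  have hbdd : ∀ z : ℤ, (∃ g, IsFiniteFlow w S T g ∧ crossSum g S = z) → z ≤ crossSum w S := by
    rintro z ⟨g, hg, rfl⟩
    exact crossSum_le_crossSum S (hg.finite.subset fun p hp => hp.2) hS fun u _ v _ => hg.le u v
  obtain ⟨z, ⟨g, hg, rfl⟩, hmax⟩ := Int.exists_greatest_of_bdd ⟨_, hbdd⟩
    ⟨_, fun _ _ => 0, ⟨by simp, by simpa using hw, by simp, by simp [rowSum]⟩, rfl⟩
  -- The residual relation of a maximum flow `g`. If `B` met `T`, a unit flow along residual steps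
  -- would raise the value by one.
  let r : V → V → Prop := fun u v => g u v < w u v
  let B : Set V := ⋃ n, reach r S n
  refine ⟨g, B, hg, Set.subset_iUnion (reach r S) 0, ?_, ?_⟩
  · rw [Set.disjoint_left]
    intro b hb hbT
    obtain ⟨n, hn⟩ := Set.mem_iUnion.1 hb
    obtain ⟨a, ha, h, h1, h2, h3, h4, -, h6⟩ := exists_unit_flow r S n b hn
    have hbS : b ∉ S := fun h => Set.disjoint_left.1 hST h hbT
    have hflow : IsFiniteFlow w S T (fun u v => g u v + h u v) := by
      refine ⟨fun u v => ?_, fun u v => ?_, ?_, fun u hu hu' => ?_⟩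
      · have := hg.antisymm u v
        have := h1 u v
        omega
      · have := hg.le u v
        have := h3 u v
        by_cases h0 : 0 < h u v
        · have : g u v < w u v := h4 u v h0
          omega
        · omega
      · refine (hg.finite.union h2).subset fun p hp => ?_
        by_contra hcon
        simp only [Set.mem_union, Set.mem_ofPred_eq, not_or, not_not] at hcon
        exact hp (by simp [hcon.1, hcon.2])
      · rw [rowSum_add u (finite_row hg.finite u) (finite_row h2 u), hg.conserved u hu hu', h6]
        have hua : u ≠ a := fun h => hu (h ▸ ha)
        have hub : u ≠ b := fun h => hu' (h ▸ hbT)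
        simp [hua, hub]
    have h7 : crossSum h S = 1 := by
      rw [crossSum_eq_finsum_rowSum h1 (h2.subset fun p hp => hp.2)]
      have : ∑ᶠ u ∈ S, rowSum h u = ∑ᶠ u ∈ ({a} : Set V), rowSum h u := by
        refine finsum_mem_inter_support_eq' _ _ _ fun u hu => ?_
        rw [Function.mem_support, h6] at hu
        constructor
        · intro huS
          by_contra hua
          have hub : u ≠ b := fun h => hbS (h ▸ huS)
          simp only [Set.mem_singleton_iff] at hua
          simp [hua, hub] at hu
        · rintro rfl
          exact ha
      rw [this, finsum_mem_singleton, h6]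
      have : a ≠ b := fun h => hbS (h ▸ ha)
      simp [this]
    have h8 := hmax _ ⟨_, hflow, rfl⟩
    rw [crossSum_add S (hg.finite.subset fun p hp => hp.2) (h2.subset fun p hp => hp.2), h7] at h8
    omega
  · intro u hu v hv
    by_contra hne
    obtain ⟨n, hn⟩ := Set.mem_iUnion.1 hu
    exact hv (Set.mem_iUnion.2 ⟨n + 1, Or.inr ⟨u, hn, lt_of_le_of_ne (hg.le u v) hne⟩⟩)

/-- If no set between `S` and `T` has less capacity than `S`, some flow from `S` to `T` saturates
all pairs that leave `S`. -/
theorem exists_saturating_flow (w : V → V → ℤ) (hw : ∀ u v, 0 ≤ w u v) {S T : Set V}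
    (hST : Disjoint S T) (hS : {p : V × V | p ∈ S ×ˢ Sᶜ ∧ w p.1 p.2 ≠ 0}.Finite)
    (hmin : ∀ B, S ⊆ B → Disjoint B T → {p : V × V | p ∈ B ×ˢ Bᶜ ∧ w p.1 p.2 ≠ 0}.Finite →
      crossSum w S ≤ crossSum w B) :
    ∃ g, IsFiniteFlow w S T g ∧ ∀ u ∈ S, ∀ v ∉ S, g u v = w u v := by
  obtain ⟨g, B, hg, hSB, hBT, hsat⟩ := exists_saturated_set w hw hST hS
  refine ⟨g, hg, eq_of_crossSum_le S (hg.finite.subset fun p hp => hp.2) hS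
    (fun u _ v _ => hg.le u v) ?_⟩
  -- The value of `g` is the capacity of the saturated set `B`, hence at least that of `S`. The
  -- boundary of `B` is finite because there `w` equals `g`, which has finite support.
  rw [← hg.crossSum_eq hSB hBT, crossSum_congr hsat]
  refine hmin B hSB hBT (hg.finite.subset fun p hp => ?_)
  rw [Set.mem_ofPred_eq, hsat p.1 hp.1.1 p.2 hp.1.2]
  exact hp.2

end FordFulkerson

/-! ### From boundary edges to ordered pairs -/

section Pairs

variable {V : Type u} {N : Network V}

open Classical in
/-- The capacity of the edge between two vertices, `0` if they are not adjacent. -/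
noncomputable def pairCap (N : Network V) (u v : V) : ℤ :=
  if h : N.graph.Adj u v then (N.cap ⟨s(u, v), h⟩ : ℤ) else 0

theorem pairCap_of_adj {u v : V} (h : N.graph.Adj u v) :
    N.pairCap u v = N.cap ⟨s(u, v), h⟩ := dif_pos h

theorem pairCap_of_not_adj {u v : V} (h : ¬ N.graph.Adj u v) : N.pairCap u v = 0 := dif_neg h

theorem pairCap_nonneg (N : Network V) (u v : V) : 0 ≤ N.pairCap u v := by
  by_cases h : N.graph.Adj u v
  · rw [pairCap_of_adj h]
    positivity
  · rw [pairCap_of_not_adj h]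

theorem pairCap_ne_zero_iff {u v : V} : N.pairCap u v ≠ 0 ↔ N.graph.Adj u v := by
  refine ⟨fun h => ?_, fun h => ?_⟩
  · by_contra h'
    exact h (pairCap_of_not_adj h')
  · rw [pairCap_of_adj h]
    have := N.cap_pos ⟨s(u, v), h⟩
    omega

theorem pairCap_comm (N : Network V) (u v : V) : N.pairCap u v = N.pairCap v u := by
  by_cases h : N.graph.Adj u v
  · rw [pairCap_of_adj h, pairCap_of_adj h.symm]
    have : (⟨s(u, v), h⟩ : N.graph.edgeSet) = ⟨s(v, u), h.symm⟩ := Subtype.ext Sym2.eq_swap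
    rw [this]
  · rw [pairCap_of_not_adj h, pairCap_of_not_adj fun h' => h h'.symm]

/-- The pairs of adjacent vertices from `A` to its complement. -/
def pairBoundary (N : Network V) (A : Set V) : Set (V × V) :=
  {p | p ∈ A ×ˢ Aᶜ ∧ N.pairCap p.1 p.2 ≠ 0}

/-- A boundary edge has exactly one orientation that leaves `A`; this carries finiteness and sums
from edges to pairs. -/
theorem exists_bijOn_pairBoundary (N : Network V) (A : Set V) :
    ∃ j : N.graph.edgeSet → V × V, (∀ e : N.graph.edgeSet, (e : Sym2 V) = s((j e).1, (j e).2)) ∧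
      Set.BijOn j (N.boundary A) (N.pairBoundary A) := by
  have h : ∀ e : N.graph.edgeSet, ∃ p : V × V, (e : Sym2 V) = s(p.1, p.2) ∧
      (e ∈ N.boundary A → p ∈ A ×ˢ Aᶜ) := by
    intro e
    by_cases he : e ∈ N.boundary A
    · obtain ⟨u, hu, v, hv, h⟩ := he
      exact ⟨(u, v), h, fun _ => ⟨hu, hv⟩⟩
    · obtain ⟨p, hp⟩ := Quot.exists_rep e.1
      exact ⟨p, hp.symm, fun h => absurd h he⟩
  choose j hj hjA using h
  have hadj : ∀ e, N.graph.Adj (j e).1 (j e).2 := fun e => by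
    have := e.2
    rwa [hj e] at this
  refine ⟨j, hj, fun e he => ⟨hjA e he, pairCap_ne_zero_iff.2 (hadj e)⟩, ?_, ?_⟩
  · intro e _ e' _ h
    exact Subtype.ext (by rw [hj e, hj e', h])
  · rintro p ⟨hp, hp'⟩
    have hpe : N.graph.Adj p.1 p.2 := pairCap_ne_zero_iff.1 hp'
    have hmem : (⟨s(p.1, p.2), hpe⟩ : N.graph.edgeSet) ∈ N.boundary A :=
      ⟨p.1, hp.1, p.2, hp.2, rfl⟩
    refine ⟨_, hmem, ?_⟩
    have h1 := hj ⟨s(p.1, p.2), hpe⟩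
    have h2 := hjA _ hmem
    rw [Sym2.eq_iff] at h1
    rcases h1 with ⟨h, h'⟩ | ⟨h, h'⟩
    · exact Prod.ext h.symm h'.symm
    · exact absurd hp.1 (h ▸ h2.2)

theorem isCut_iff_finite_pairBoundary {A : Set V} : N.IsCut A ↔ (N.pairBoundary A).Finite := by
  obtain ⟨j, -, hj⟩ := exists_bijOn_pairBoundary N A
  exact hj.finite_iff_finite

/-- A sum over the boundary edges of `A` as a sum over pairs. -/
theorem finsum_boundary_eq_crossSum (A : Set V) (φ : N.graph.edgeSet → ℤ) (g : V → V → ℤ)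
    (hg0 : ∀ u v, ¬ N.graph.Adj u v → g u v = 0)
    (hg : ∀ u ∈ A, ∀ v ∉ A, ∀ e : N.graph.edgeSet, (e : Sym2 V) = s(u, v) → φ e = g u v) :
    ∑ᶠ e ∈ N.boundary A, φ e = crossSum g A := by
  obtain ⟨j, hj, hbij⟩ := exists_bijOn_pairBoundary N A
  have h1 : ∑ᶠ e ∈ N.boundary A, φ e = ∑ᶠ p ∈ N.pairBoundary A, g p.1 p.2 := by
    refine finsum_mem_eq_of_bijOn j hbij fun e he => ?_
    have := hbij.mapsTo he
    exact hg _ this.1.1 _ this.1.2 e (hj e)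
  rw [h1]
  refine finsum_mem_inter_support_eq' _ _ _ fun p hp => ⟨fun h => h.1, fun h => ⟨h, ?_⟩⟩
  rw [pairCap_ne_zero_iff]
  by_contra hadj
  exact hp (hg0 _ _ hadj)

theorem crossSum_pairCap {A : Set V} (hA : N.IsCut A) : crossSum N.pairCap A = N.cutCap A := by
  rw [← finsum_boundary_eq_crossSum A (fun e => (N.cap e : ℤ)) N.pairCap
    (fun u v => pairCap_of_not_adj)]
  · rw [cutCap, finsum_mem_eq_finite_toFinset_sum _ hA, finsum_mem_eq_finite_toFinset_sum _ hA,
      Nat.cast_sum]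
  · rintro u - v - e he
    have hadj : N.graph.Adj u v := by
      have := e.2
      rwa [he] at this
    rw [pairCap_of_adj hadj]
    congr 2
    exact Subtype.ext he

theorem boundary_compl (N : Network V) (A : Set V) : N.boundary Aᶜ = N.boundary A := by
  ext e
  constructor
  · rintro ⟨u, hu, v, hv, h⟩
    exact ⟨v, not_not.1 hv, u, hu, h.trans Sym2.eq_swap⟩
  · rintro ⟨u, hu, v, hv, h⟩
    exact ⟨v, hv, u, not_not.2 hu, h.trans Sym2.eq_swap⟩

theorem cutCap_compl (N : Network V) (A : Set V) : N.cutCap Aᶜ = N.cutCap A := by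
  rw [cutCap, cutCap, boundary_compl]

/-- A set that is neither empty nor everything has an edge in its boundary. -/
theorem boundary_nonempty {A : Set V} (h : A.Nonempty) (h' : Aᶜ.Nonempty) :
    (N.boundary A).Nonempty := by
  obtain ⟨a, ha⟩ := h
  obtain ⟨b, hb⟩ := h'
  obtain ⟨w⟩ := N.connected.preconnected a b
  obtain ⟨d, -, hd, hd'⟩ := w.exists_boundary_dart A ha hb
  exact ⟨⟨d.edge, d.edge_mem⟩, d.fst, hd, d.snd, hd', rfl⟩

theorem LiesIn.nonempty {A : Set V} {x : N.Point} (h : N.LiesIn A x) : A.Nonempty := by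
  cases x with
  | inl v => exact ⟨v, h⟩
  | inr ω =>
    obtain ⟨R, hR⟩ := Quotient.exists_rep ω
    obtain ⟨n, hn⟩ := (h R hR).exists
    exact ⟨_, hn⟩

/-- All rays of an end follow one representative, since the cut `A` cannot separate equivalent rays.
-/
theorem IsCut.liesIn_or {A : Set V} (hA : N.IsCut A) (x : N.Point) :
    N.LiesIn A x ∨ N.LiesIn Aᶜ x := by
  cases x with
  | inl v => exact Classical.em _
  | inr ω =>
    obtain ⟨R, hR⟩ := Quotient.exists_rep ω
    have key : ∀ R' : N.Ray, R'.toEnd = ω → ¬ ∃ A, N.IsCut A ∧ N.SeparatesRays A R R' :=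
      fun R' hR' => Quotient.exact (s := N.raySetoid) (hR.trans hR'.symm)
    rcases R.eventually_mem_or N hA with h | h
    · refine Or.inl fun R' hR' => (R'.eventually_mem_or N hA).resolve_right fun h' => ?_
      exact key R' hR' ⟨A, hA, Or.inl (h.and h')⟩
    · refine Or.inr fun R' hR' => (R'.eventually_mem_or N hA).resolve_left fun h' => ?_
      exact key R' hR' ⟨A, hA, Or.inr (h.and h')⟩

end Pairs

/-! ### Minimal cuts around a point, and flows between them -/

section HalfFlow

variable {V : Type u} {N : Network V}

/-- `K` is a cut that contains `x` and has the least capacity among all such cuts inside `K`. -/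
structure IsMinCutAt (N : Network V) (x : N.Point) (K : Set V) : Prop where
  isCut : N.IsCut K
  liesIn : N.LiesIn K x
  le : ∀ D, N.IsCut D → D ⊆ K → N.LiesIn D x → N.cutCap K ≤ N.cutCap D

/-- A flow from the complement of `C` to `x` that saturates the boundary of `C`, described in `C`
only. -/
structure IsHalfFlow (N : Network V) (x : N.Point) (C : Set V) (G : V → V → ℤ) : Prop where
  antisymm : ∀ u v, G u v = -G v u
  le : ∀ u v, G u v ≤ N.pairCap u v
  saturated : ∀ u ∉ C, ∀ v ∈ C, G u v = N.pairCap u v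
  finite : ∀ u ∈ C, {v | G u v ≠ 0}.Finite
  conserved : ∀ u ∈ C, Sum.inl u ≠ x →
    (∀ ω : N.End, Sum.inr ω = x → N.Separable (Sum.inl u) (Sum.inr ω)) → rowSum G u = 0
  crossSum_eq_zero : ∀ B, N.IsCut B → B ⊆ C → N.LiesIn Bᶜ x → crossSum G B = 0

/-- The case of a point that is a vertex or cannot be separated from some vertex. -/
theorem IsMinCutAt.exists_halfFlow_of_vertex {x : N.Point} {C : Set V} (hC : N.IsMinCutAt x C)
    (v₀ : V) (hx : Sum.inl v₀ = x ∨ ∃ ω : N.End, Sum.inr ω = x ∧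
      ¬ N.Separable (Sum.inl v₀) (Sum.inr ω)) : ∃ G, N.IsHalfFlow x C G := by
  -- Every cut that contains `v₀` contains `x`, so `v₀` can replace `x` as the sink.
  have hmem : ∀ B, N.IsCut B → v₀ ∈ B → N.LiesIn B x := by
    intro B hB hv
    rcases hx with rfl | ⟨ω, rfl, hω⟩
    · exact hv
    · exact (hB.liesIn_or _).resolve_right fun h => hω ⟨B, hB, Or.inl ⟨hv, h⟩⟩
  have hvC : v₀ ∈ C := by
    by_contra h
    exact hC.liesIn.not_compl (hmem _ hC.isCut.compl h)
  obtain ⟨G, hG, hsat⟩ := exists_saturating_flow N.pairCap N.pairCap_nonneg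
    (S := Cᶜ) (T := {v₀}) (Set.disjoint_singleton_right.2 (not_not.2 hvC))
    (isCut_iff_finite_pairBoundary.1 hC.isCut.compl) (by
      intro B hCB hB hfin
      have hBcut : N.IsCut B := isCut_iff_finite_pairBoundary.2 hfin
      rw [crossSum_pairCap hC.isCut.compl, crossSum_pairCap hBcut, cutCap_compl, ← cutCap_compl N B]
      exact_mod_cast hC.le _ hBcut.compl (Set.compl_subset_comm.1 hCB)
        (hmem _ hBcut.compl (Set.disjoint_singleton_right.1 hB)))
  refine ⟨G, hG.antisymm, hG.le, fun u hu v hv => hsat u hu v (not_not.2 hv),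
    fun u _ => finite_row hG.finite u, fun u hu hux hω => ?_, fun B hB hBC hBx => ?_⟩
  · refine hG.conserved u (not_not.2 hu) fun h => ?_
    rw [Set.mem_singleton_iff] at h
    subst h
    rcases hx with h | ⟨ω, h, h'⟩
    · exact hux h
    · exact h' (hω ω h)
  · refine Network.crossSum_eq_zero hG.antisymm (hG.finite.subset fun p hp => hp.2) fun u hu => ?_
    refine hG.conserved u (not_not.2 (hBC hu)) fun h => ?_
    rw [Set.mem_singleton_iff] at h
    subst h
    exact (hmem B hB hu).not_compl hBx

theorem exists_isMinCutAt {x : N.Point} {J : Set V} (hJ : N.IsCut J) (hx : N.LiesIn J x) :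
    ∃ K, K ⊆ J ∧ N.IsMinCutAt x K := by
  let s : Set ℕ := {k | ∃ K, N.IsCut K ∧ K ⊆ J ∧ N.LiesIn K x ∧ N.cutCap K = k}
  have hs : s.Nonempty := ⟨_, J, hJ, subset_rfl, hx, rfl⟩
  obtain ⟨K, h1, h2, h3, h4⟩ := Nat.sInf_mem hs
  exact ⟨K, h2, h1, h3, fun D hD hDK hDx =>
    h4.trans_le (Nat.sInf_le ⟨D, hD, hDK.trans h2, hDx, rfl⟩)⟩

theorem cutCap_lt_cutCap {D K : Set V} (hK : N.IsCut K) (hsub : N.boundary D ⊆ N.boundary K)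
    {e : N.graph.edgeSet} (he : e ∈ N.boundary K) (he' : e ∉ N.boundary D) :
    N.cutCap D < N.cutCap K := by
  have hD : N.IsCut D := Set.Finite.subset hK hsub
  rw [cutCap, cutCap, finsum_mem_eq_finite_toFinset_sum _ hD,
    finsum_mem_eq_finite_toFinset_sum _ hK]
  refine Finset.sum_lt_sum_of_subset (i := e) ?_ ((Set.Finite.mem_toFinset hK).2 he)
    (fun h => he' ((Set.Finite.mem_toFinset hD).1 h)) (N.cap_pos e) (fun _ _ _ => Nat.zero_le _)
  exact fun a ha => (Set.Finite.mem_toFinset hK).2 (hsub ((Set.Finite.mem_toFinset hD).1 ha))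

/-- If all vertices can be separated from the end `ω`, there is a minimal cut at `ω` that is
surrounded by a given one. -/
theorem IsMinCutAt.exists_inner {ω : N.End} (hω : ∀ v, N.Separable (Sum.inl v) (Sum.inr ω))
    {K : Set V} (hK : N.IsMinCutAt (Sum.inr ω) K) :
    ∃ K', N.IsMinCutAt (Sum.inr ω) K' ∧ K' ⊆ K ∧ ∀ u ∈ K', ∀ v, N.graph.Adj u v → v ∈ K := by
  have hP : (Prod.fst '' N.pairBoundary K).Finite :=
    (isCut_iff_finite_pairBoundary.1 hK.isCut).image _
  -- Finitely many vertices can be cut off from `ω` at once. This is applied to the inner endpoints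
  -- of the boundary of `K`.
  have key : ∀ P : Set V, P.Finite →
      ∃ J, N.IsCut J ∧ N.LiesIn J (Sum.inr ω) ∧ J ⊆ K ∧ ∀ u ∈ P, u ∉ J := by
    intro P hP
    induction P, hP using Set.Finite.induction_on with
    | empty => exact ⟨K, hK.isCut, hK.liesIn, subset_rfl, by simp⟩
    | @insert a s _ _ ih =>
      obtain ⟨J, h1, h2, h3, h4⟩ := ih
      obtain ⟨A, hA, haA, hAω⟩ : ∃ A, N.IsCut A ∧ a ∉ A ∧ N.LiesIn A (Sum.inr ω) := by
        obtain ⟨A, hA, h | h⟩ := hω a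
        · exact ⟨Aᶜ, hA.compl, not_not.2 h.1, h.2⟩
        · exact ⟨A, hA, h.1, h.2⟩
      refine ⟨J ∩ A, h1.inter hA, h2.inter hAω, Set.inter_subset_left.trans h3, ?_⟩
      rintro u (rfl | hu)
      · exact fun h => haA h.2
      · exact fun h => h4 u hu h.1
  obtain ⟨J, h1, h2, h3, h4⟩ := key _ hP
  obtain ⟨K', hK'J, hK'⟩ := exists_isMinCutAt h1 h2
  refine ⟨K', hK', hK'J.trans h3, fun u hu v huv => ?_⟩
  by_contra hv
  exact h4 u ⟨(u, v), ⟨⟨h3 (hK'J hu), hv⟩, pairCap_ne_zero_iff.2 huv⟩, rfl⟩ (hK'J hu)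

/-- A flow between nested minimal cuts with prescribed values on the boundary of the outer one. -/
theorem IsMinCutAt.exists_flow_between {x : N.Point} {K K' : Set V} (hK : N.IsMinCutAt x K)
    (hK' : N.IsMinCutAt x K') (hsub : K' ⊆ K) (p : V → V → ℤ)
    (hp : ∀ u ∉ K, ∀ v ∈ K, 0 ≤ p u v ∧ p u v ≤ N.pairCap u v) :
    ∃ g : V → V → ℤ, (∀ u v, g u v = -g v u) ∧ (∀ u v, g u v ≤ N.pairCap u v) ∧
      {q : V × V | g q.1 q.2 ≠ 0}.Finite ∧ (∀ u ∈ K, u ∉ K' → rowSum g u = 0) ∧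
      (∀ u ∉ K, ∀ v ∈ K, g u v = p u v) ∧ ∀ u ∉ K', ∀ v ∈ K', 0 ≤ g u v := by
  classical
  -- Pairs entering `K` get the prescribed value as capacity. Pairs starting in `K'` get `0`, so
  -- nothing flows back out of `K'`. The function `d` is the capacity lost at the entrance to `K`.
  let w : V → V → ℤ := fun u v =>
    if u ∉ K ∧ v ∈ K then p u v else if u ∈ K' then 0 else N.pairCap u v
  let d : V → V → ℤ := fun u v => if u ∉ K ∧ v ∈ K then N.pairCap u v - p u v else 0
  have hw1 : ∀ u v, u ∉ K → v ∈ K → w u v = p u v := fun u v hu hv => if_pos ⟨hu, hv⟩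
  have hw2 : ∀ u v, u ∈ K' → w u v = 0 := fun u v hu => by
    have : ¬ (u ∉ K ∧ v ∈ K) := fun h => h.1 (hsub hu)
    simp only [w, if_neg this, if_pos hu]
  have hw3 : ∀ u v, ¬ (u ∉ K ∧ v ∈ K) → u ∉ K' → w u v = N.pairCap u v := fun u v h hu => by
    simp only [w, if_neg h, if_neg hu]
  have hw : ∀ u v, 0 ≤ w u v ∧ w u v ≤ N.pairCap u v := by
    intro u v
    by_cases h : u ∉ K ∧ v ∈ K
    · rw [hw1 u v h.1 h.2]
      exact hp u h.1 v h.2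
    · by_cases hu : u ∈ K'
      · rw [hw2 u v hu]
        exact ⟨le_rfl, N.pairCap_nonneg u v⟩
      · rw [hw3 u v h hu]
        exact ⟨N.pairCap_nonneg u v, le_rfl⟩
  have hd0 : ∀ u v, 0 ≤ d u v := fun u v => by
    by_cases h : u ∉ K ∧ v ∈ K
    · simp only [d, if_pos h]
      have := (hp u h.1 v h.2).2
      omega
    · simp only [d, if_neg h, le_refl]
  have hdle : ∀ u v, d u v ≠ 0 → (u, v) ∈ N.pairBoundary Kᶜ := fun u v huv => by
    by_cases h : u ∉ K ∧ v ∈ K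
    · refine ⟨⟨h.1, not_not.2 h.2⟩, fun h0 => huv ?_⟩
      have := hp u h.1 v h.2
      change N.pairCap u v = 0 at h0
      simp only [d, if_pos h]
      omega
    · exact absurd (if_neg h) huv
  have hKfin : (N.pairBoundary Kᶜ).Finite := isCut_iff_finite_pairBoundary.1 hK.isCut.compl
  have hsum : ∀ B, Disjoint B K' → N.IsCut B → {q : V × V | q ∈ B ×ˢ Bᶜ ∧ w q.1 q.2 ≠ 0}.Finite →
      crossSum w B + crossSum d B = N.cutCap B := by
    intro B hB hBcut hfin
    rw [← crossSum_pairCap hBcut, ← crossSum_add B hfin (hKfin.subset fun q hq => hdle _ _ hq.2)]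
    refine crossSum_congr fun u hu v hv => ?_
    by_cases h : u ∉ K ∧ v ∈ K
    · rw [hw1 u v h.1 h.2]
      simp only [d, if_pos h]
      ring
    · rw [hw3 u v h (Set.disjoint_left.1 hB hu)]
      simp only [d, if_neg h, add_zero]
  have hdisj : Disjoint Kᶜ K' := Set.disjoint_left.2 fun a ha ha' => ha (hsub ha')
  have hSfin : {q : V × V | q ∈ Kᶜ ×ˢ Kᶜᶜ ∧ w q.1 q.2 ≠ 0}.Finite :=
    hKfin.subset fun q hq => ⟨hq.1, fun h0 => hq.2 (by have := hw q.1 q.2; omega)⟩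
  obtain ⟨g, hg, hsat⟩ := exists_saturating_flow w (fun u v => (hw u v).1) hdisj hSfin (by
    intro B hKB hB hfin
    have hBcut : N.IsCut B := by
      refine isCut_iff_finite_pairBoundary.2 ((hfin.union hKfin).subset fun q hq => ?_)
      by_cases h : q.1 ∉ K ∧ q.2 ∈ K
      · exact Or.inr ⟨⟨h.1, not_not.2 h.2⟩, hq.2⟩
      · refine Or.inl ⟨hq.1, ?_⟩
        rw [hw3 _ _ h (Set.disjoint_left.1 hB hq.1.1)]
        exact hq.2
    have h1 := hsum B hB hBcut hfin
    have h2 := hsum Kᶜ hdisj hK.isCut.compl hSfin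
    -- The deficit sits on pairs from `Kᶜ` to `K`, and all of those that leave `B` are among the
    -- pairs leaving `Kᶜ`. Together with `cutCap K ≤ cutCap B` this shows that lowering the
    -- capacities keeps `Kᶜ` minimal.
    have h3 : crossSum d B ≤ crossSum d Kᶜ := by
      let d' : V → V → ℤ := fun u v => if v ∈ B then 0 else d u v
      have hd' : ∀ u v, d' u v ≠ 0 → v ∉ B ∧ d u v ≠ 0 := fun u v h => by
        by_cases hv : v ∈ B
        · exact absurd (if_pos hv) h
        · exact ⟨hv, by simpa only [d', if_neg hv] using h⟩
      have h4 : crossSum d B = crossSum d' B := crossSum_congr fun u _ v hv => by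
        simp only [d', if_neg hv]
      have h5 : crossSum d' B = crossSum d' Kᶜ := by
        refine finsum_mem_inter_support_eq' _ _ _ fun q hq => ?_
        obtain ⟨h6, h7⟩ := hd' _ _ hq
        have h8 := (hdle _ _ h7).1
        exact iff_of_true ⟨hKB h8.1, h6⟩ h8
      rw [h4, h5]
      refine crossSum_le_crossSum _ (hKfin.subset fun q hq => hdle _ _ (hd' _ _ hq.2).2)
        (hKfin.subset fun q hq => hdle _ _ hq.2) fun u _ v _ => ?_
      by_cases hv : v ∈ B
      · simp only [d', if_pos hv]
        exact hd0 u v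
      · simp only [d', if_neg hv, le_refl]
    have h4 : N.cutCap K ≤ N.cutCap Bᶜ := hK.le _ hBcut.compl (Set.compl_subset_comm.1 hKB)
      (hK'.liesIn.mono fun a ha ha' => Set.disjoint_left.1 hB ha' ha)
    rw [cutCap_compl] at h4 h2
    omega)
  refine ⟨g, hg.antisymm, fun u v => (hg.le u v).trans (hw u v).2, hg.finite,
    fun u hu hu' => hg.conserved u (not_not.2 hu) hu', fun u hu v hv => ?_, fun u _ v hv => ?_⟩
  · rw [hsat u hu v (not_not.2 hv), hw1 u v hu hv]
  · have h1 := hg.le v u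
    rw [hw2 v u hv] at h1
    have h2 := hg.antisymm u v
    omega

end HalfFlow

/-! ### Gluing flows along nested cuts that shrink to an end -/

section EndFlow

variable {V : Type u} {N : Network V}

/-- The case of an end that can be separated from all vertices. -/
theorem IsMinCutAt.exists_halfFlow_of_end {ω : N.End}
    (hω : ∀ v, N.Separable (Sum.inl v) (Sum.inr ω)) {C : Set V}
    (hC : N.IsMinCutAt (Sum.inr ω) C) (hC' : Cᶜ.Nonempty) :
    ∃ G, N.IsHalfFlow (Sum.inr ω) C G := by
  classical
  obtain ⟨K, hK0, hK, hKsub, hKadj⟩ : ∃ K : ℕ → Set V, K 0 = C ∧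
      (∀ i, N.IsMinCutAt (Sum.inr ω) (K i)) ∧ (∀ i, K (i + 1) ⊆ K i) ∧
      ∀ i, ∀ u ∈ K (i + 1), ∀ v, N.graph.Adj u v → v ∈ K i := by
    choose! F hF1 hF2 hF3 using
      fun (K : Set V) (hK : N.IsMinCutAt (Sum.inr ω) K) => hK.exists_inner hω
    have h : ∀ i, N.IsMinCutAt (Sum.inr ω) (F^[i] C) := fun i => by
      induction i with
      | zero => exact hC
      | succ i ih =>
        rw [Function.iterate_succ_apply']
        exact hF1 _ ih
    refine ⟨fun i => F^[i] C, rfl, h, fun i => ?_, fun i => ?_⟩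
    · simp only [Function.iterate_succ_apply']
      exact hF2 _ (h i)
    · simp only [Function.iterate_succ_apply']
      exact hF3 _ (h i)
  have hKanti : Antitone K := antitone_nat_of_succ_le hKsub
  -- A step along an edge leaves at most one of the nested cuts. A walk of length `n` from `u` to a
  -- vertex outside `C` thus excludes `u` from `K n`.
  have hout : ∀ u, ∃ i, u ∉ K i := by
    intro u
    obtain ⟨x₀, hx₀⟩ := hC'
    obtain ⟨q⟩ := N.connected.preconnected u x₀
    refine ⟨q.length, ?_⟩
    induction q with
    | nil => simpa [hK0] using hx₀
    | cons h q ih => exact fun hu => ih hx₀ (hKadj _ _ hu _ h)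
  let lev : V → ℕ := fun u => Nat.find (hout u)
  have hlev : ∀ u i, u ∈ K i ↔ i < lev u := by
    intro u i
    constructor
    · intro hu
      by_contra hlt
      exact Nat.find_spec (hout u) (hKanti (not_lt.1 hlt) hu)
    · intro hi
      by_contra hu
      exact Nat.find_min (hout u) hi hu
  have hlevC : ∀ u, u ∈ C ↔ 0 < lev u := fun u => by rw [← hlev, hK0]
  have hlevadj : ∀ u v, N.graph.Adj u v → lev u ≤ lev v + 1 := by
    intro u v huv
    by_contra hlt
    have h1 : u ∈ K (lev v + 1) := (hlev _ _).2 (not_le.1 hlt)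
    exact lt_irrefl _ ((hlev _ _).1 (hKadj _ _ h1 v huv))
  -- Choose `i` so large that `K i` contains no endpoint of the finite boundary of `B`. If `K i` met
  -- `B`, removing `B` from `K i` would lose a boundary edge and gain none, contrary to minimality
  -- of `K i`.
  have hbase : ∀ B, N.IsCut B → N.LiesIn Bᶜ (Sum.inr ω) → ∃ i, K i ⊆ Bᶜ := by
    intro B hB hBω
    have hfin := isCut_iff_finite_pairBoundary.1 hB
    obtain ⟨i, hi⟩ := ((hfin.image fun p => lev p.1).union (hfin.image fun p => lev p.2)).bddAbove
    have hi1 : ∀ a ∈ B, ∀ b ∉ B, N.graph.Adj a b → a ∉ K i ∧ b ∉ K i := by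
      intro a ha b hb hab
      have hmem : (a, b) ∈ N.pairBoundary B := ⟨⟨ha, hb⟩, pairCap_ne_zero_iff.2 hab⟩
      rw [hlev, hlev, not_lt, not_lt]
      exact ⟨hi (Or.inl ⟨_, hmem, rfl⟩), hi (Or.inr ⟨_, hmem, rfl⟩)⟩
    refine ⟨i, fun a ha haB => ?_⟩
    have hD : N.IsCut (K i ∩ Bᶜ) := (hK i).isCut.inter hB.compl
    have hDω := (hK i).liesIn.inter hBω
    obtain ⟨b, hb⟩ := hDω.nonempty
    obtain ⟨e, u, hu, v, hv, he⟩ := boundary_nonempty (N := N) (A := K i ∩ B) ⟨a, ha, haB⟩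
      ⟨b, fun h => hb.2 h.2⟩
    have huv : N.graph.Adj u v := by
      have := e.2
      rwa [he] at this
    have hvK : v ∉ K i := fun h =>
      (hi1 u hu.2 v (fun h' => hv ⟨h, h'⟩) huv).1 hu.1
    refine absurd ((hK i).le _ hD Set.inter_subset_left hDω) (not_le.2
      (cutCap_lt_cutCap (hK i).isCut ?_ ⟨u, hu.1, v, hvK, he⟩ ?_))
    · rintro e' ⟨x, hx, y, hy, he'⟩
      refine ⟨x, hx.1, y, fun hyK => ?_, he'⟩
      have hxy : N.graph.Adj x y := by
        have := e'.2
        rwa [he'] at this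
      have hyB : y ∈ B := by
        by_contra h
        exact hy ⟨hyK, h⟩
      exact (hi1 y hyB x hx.2 hxy.symm).1 hyK
    · rintro ⟨x, hx, y, hy, he'⟩
      rw [he, Sym2.eq_iff] at he'
      rcases he' with ⟨rfl, rfl⟩ | ⟨rfl, rfl⟩
      · exact hx.2 hu.2
      · exact hvK hx.1
  -- The invariant of the recursion. Nonnegativity into `K i` is what allows these values to serve
  -- as capacities in the next stage.
  let Q : ℕ → (V → V → ℤ) → Prop := fun i g => (∀ u v, g u v = -g v u) ∧
    (∀ u v, g u v ≤ N.pairCap u v) ∧ ∀ u ∉ K i, ∀ v ∈ K i, 0 ≤ g u v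
  obtain ⟨g, hg0, hgQ, hgfin, hgcons, hgK⟩ : ∃ g : ℕ → V → V → ℤ,
      (∀ u ∉ C, ∀ v ∈ C, g 0 u v = N.pairCap u v) ∧ (∀ i, Q i (g i)) ∧
      (∀ i, {q : V × V | g (i + 1) q.1 q.2 ≠ 0}.Finite) ∧
      (∀ i, ∀ u ∈ K i, u ∉ K (i + 1) → rowSum (g (i + 1)) u = 0) ∧
      ∀ i, ∀ u ∉ K i, ∀ v ∈ K i, g (i + 1) u v = g i u v := by
    have hstep : ∀ i (p : {p // Q i p}), ∃ g : {g // Q (i + 1) g},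
        {q : V × V | g.1 q.1 q.2 ≠ 0}.Finite ∧
        (∀ u ∈ K i, u ∉ K (i + 1) → rowSum g.1 u = 0) ∧
        ∀ u ∉ K i, ∀ v ∈ K i, g.1 u v = p.1 u v := by
      rintro i ⟨p, -, hp2, hp3⟩
      obtain ⟨g, h1, h2, h3, h4, h5, h6⟩ := (hK i).exists_flow_between (hK (i + 1)) (hKsub i) p
        fun u hu v hv => ⟨hp3 u hu v hv, hp2 u v⟩
      exact ⟨⟨g, h1, h2, h6⟩, h3, h4, h5⟩
    choose F hF1 hF2 hF3 using hstep
    let b : V → V → ℤ := fun u v =>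
      if u ∉ C ∧ v ∈ C then N.pairCap u v else if u ∈ C ∧ v ∉ C then -N.pairCap u v else 0
    have hb1 : ∀ u v, u ∉ C → v ∈ C → b u v = N.pairCap u v := fun u v hu hv => if_pos ⟨hu, hv⟩
    have hb2 : ∀ u v, u ∈ C → v ∉ C → b u v = -N.pairCap u v := fun u v hu hv => by
      simp only [b, not_true_eq_false, hu, hv, and_self, if_false, if_true, not_false_eq_true]
    have hb3 : ∀ u v, (u ∈ C ↔ v ∈ C) → b u v = 0 := fun u v h => by
      simp only [b, h]
      simp
    have hb : Q 0 b := by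
      refine ⟨fun u v => ?_, fun u v => ?_, fun u hu v hv => ?_⟩
      · have := N.pairCap_comm u v
        by_cases hu : u ∈ C <;> by_cases hv : v ∈ C
        · rw [hb3 u v (by tauto), hb3 v u (by tauto), neg_zero]
        · rw [hb2 u v hu hv, hb1 v u hv hu, this]
        · rw [hb1 u v hu hv, hb2 v u hv hu, this, neg_neg]
        · rw [hb3 u v (by tauto), hb3 v u (by tauto), neg_zero]
      · have := N.pairCap_nonneg u v
        by_cases hu : u ∈ C <;> by_cases hv : v ∈ C
        · rwa [hb3 u v (by tauto)]
        · rw [hb2 u v hu hv]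
          omega
        · rw [hb1 u v hu hv]
        · rwa [hb3 u v (by tauto)]
      · rw [hK0] at hu hv
        rw [hb1 u v hu hv]
        exact N.pairCap_nonneg u v
    let f : ∀ i, {p // Q i p} := fun i =>
      Nat.rec (motive := fun i => {p // Q i p}) ⟨b, hb⟩ (fun i p => F i p) i
    exact ⟨fun i => (f i).1, fun u hu v hv => hb1 u v hu hv, fun i => (f i).2,
      fun i => hF1 i (f i), fun i => hF2 i (f i), fun i => hF3 i (f i)⟩
  have hgz : ∀ i u v, ¬ N.graph.Adj u v → g i u v = 0 := fun i u v h => by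
    have h1 := (hgQ i).1 u v
    have h2 := (hgQ i).2.1 u v
    have h3 := (hgQ i).2.1 v u
    rw [pairCap_of_not_adj h] at h2
    rw [pairCap_of_not_adj fun h' => h h'.symm] at h3
    omega
  -- Each vertex of positive level takes its row from the flow conserved on its own layer `K (lev u
  -- - 1) \ K (lev u)`. Adjacent levels differ by at most one, and consecutive flows agree on the
  -- boundary between them, so `G` is antisymmetric.
  let G : V → V → ℤ := fun u v => g (lev u) u v
  have hsucc : ∀ u v, lev v = lev u + 1 → G u v = -G v u := by
    intro u v h
    have h1 : g (lev u + 1) u v = g (lev u) u v :=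
      hgK _ u (fun h' => lt_irrefl _ ((hlev _ _).1 h')) v ((hlev _ _).2 (by omega))
    simp only [G, h]
    rw [← h1, (hgQ _).1 u v]
  have hanti : ∀ u v, G u v = -G v u := by
    intro u v
    by_cases hadj : N.graph.Adj u v
    · have h1 := hlevadj u v hadj
      have h2 := hlevadj v u hadj.symm
      rcases lt_trichotomy (lev u) (lev v) with h | h | h
      · exact hsucc u v (by omega)
      · simp only [G, h]
        exact (hgQ _).1 u v
      · rw [hsucc v u (by omega), neg_neg]
    · simp only [G]
      rw [hgz _ u v hadj, hgz _ v u fun h => hadj h.symm, neg_zero]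
  have hrow : ∀ u ∈ C, rowSum G u = 0 := by
    intro u hu
    obtain ⟨i, hi⟩ := Nat.exists_eq_succ_of_ne_zero ((hlevC u).1 hu).ne'
    have : rowSum G u = rowSum (g (i + 1)) u := by
      simp only [rowSum, G, hi, Nat.succ_eq_add_one]
    rw [this]
    exact hgcons i u ((hlev _ _).2 (by omega)) fun h => by
      have := (hlev _ _).1 h
      omega
  refine ⟨G, hanti, fun u v => (hgQ _).2.1 u v, fun u hu v hv => ?_, fun u hu => ?_,
    fun u hu _ _ => hrow u hu, fun B hB hBC hBω => ?_⟩
  · have : lev u = 0 := by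
      have := (hlevC u).not.1 hu
      omega
    simp only [G, this]
    exact hg0 u hu v hv
  · obtain ⟨i, hi⟩ := Nat.exists_eq_succ_of_ne_zero ((hlevC u).1 hu).ne'
    simp only [G, hi]
    exact finite_row (hgfin i) u
  · obtain ⟨i, hi⟩ := hbase B hB hBω
    refine Network.crossSum_eq_zero hanti ?_ fun u hu => hrow u (hBC hu)
    -- As `B` lies in `C` and misses `K i`, its levels run from `1` to `i`; only finitely many of
    -- the finite flows occur.
    refine ((Set.finite_lt_nat i).biUnion fun j _ => hgfin j).subset ?_
    rintro p ⟨hp, hp'⟩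
    obtain ⟨j, hj⟩ := Nat.exists_eq_succ_of_ne_zero ((hlevC p.1).1 (hBC hp)).ne'
    have hji : j < i := by
      by_contra h
      exact hi ((hlev p.1 i).2 (by omega)) hp
    refine Set.mem_biUnion (x := j) hji ?_
    simp only [G, hj] at hp'
    exact hp'

theorem IsMinCutAt.exists_halfFlow {x : N.Point} {C : Set V} (hC : N.IsMinCutAt x C)
    (hC' : Cᶜ.Nonempty) : ∃ G, N.IsHalfFlow x C G := by
  cases x with
  | inl v => exact hC.exists_halfFlow_of_vertex v (Or.inl rfl)
  | inr ω =>
    by_cases hω : ∀ v, N.Separable (Sum.inl v) (Sum.inr ω)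
    · exact hC.exists_halfFlow_of_end hω hC'
    · obtain ⟨v, hv⟩ := not_forall.1 hω
      exact hC.exists_halfFlow_of_vertex v (Or.inr ⟨ω, rfl, hv⟩)

end EndFlow

/-! ### Assembling the flow and comparing it with cuts -/

section MaxFlowMinCut

variable {V : Type u} {N : Network V}

/-- Finiteness is required only where `f` is nonzero, so that the formula also covers a single
vertex of infinite degree, which need not be a cut. -/
theorem DirectedAssignment.net_eq_finsum (f : N.DirectedAssignment) {A : Set V}
    {φ : N.graph.edgeSet → ℤ}
    (hfin : {e | e ∈ N.boundary A ∧ f.val e ≠ 0}.Finite)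
    (hφ : ∀ e, f.init e ∈ A → φ e = f.val e) (hφ' : ∀ e, f.init e ∉ A → φ e = -f.val e) :
    f.net A = ∑ᶠ e ∈ N.boundary A, φ e := by
  classical
  have h₀ : ∑ᶠ e ∈ N.boundary A, φ e = ∑ e ∈ hfin.toFinset, φ e := by
    refine finsum_mem_eq_sum_of_inter_support_eq _ ?_
    ext e
    simp only [Set.mem_inter_iff, Function.mem_support, Set.Finite.coe_toFinset, Set.mem_ofPred_eq]
    refine ⟨fun h => ⟨⟨h.1, fun h0 => h.2 ?_⟩, h.2⟩, fun h => ⟨h.1.1, h.2⟩⟩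
    by_cases he : f.init e ∈ A
    · rw [hφ e he, h0, Nat.cast_zero]
    · rw [hφ' e he, h0, Nat.cast_zero, neg_zero]
  have key : ∀ B : Set V, (∑ᶠ e ∈ {e | e ∈ N.boundary A ∧ f.init e ∈ B}, f.val e) =
      ∑ e ∈ hfin.toFinset, if f.init e ∈ B then f.val e else 0 := by
    intro B
    rw [← Finset.sum_filter]
    refine finsum_mem_eq_sum_of_inter_support_eq _ ?_
    ext e
    simp only [Set.mem_inter_iff, Function.mem_support, Set.Finite.mem_toFinset, Finset.coe_filter,
      Set.mem_ofPred_eq]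
    tauto
  rw [h₀, net, outOf, inTo, key A, key Aᶜ, Nat.cast_sum, Nat.cast_sum, ← Finset.sum_sub_distrib]
  refine Finset.sum_congr rfl fun e _ => ?_
  by_cases he : f.init e ∈ A
  · simp [he, hφ e he]
  · simp [he, hφ' e he]

theorem DirectedAssignment.mem_edge_iff (f : N.DirectedAssignment) (e : N.graph.edgeSet) (v : V) :
    v ∈ (e : Sym2 V) ↔ f.init e = v ∨ f.term e = v := by
  have he : (e : Sym2 V) = s(f.init e, f.term e) := (f.dir_edge e).symm
  rw [he, Sym2.mem_iff, eq_comm, @eq_comm _ v]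

theorem DirectedAssignment.init_ne_term (f : N.DirectedAssignment) (e : N.graph.edgeSet) :
    f.init e ≠ f.term e := (f.dir e).adj.ne

theorem DirectedAssignment.outAt_eq_outOf (f : N.DirectedAssignment) (v : V) :
    f.outAt v = f.outOf {v} := by
  refine finsum_mem_congr (Set.ext fun e => ?_) fun _ _ => rfl
  have := f.init_ne_term e
  rw [Set.mem_ofPred_eq, Set.mem_ofPred_eq]
  rw [mem_boundary_iff f]
  simp only [Set.mem_singleton_iff]
  grind

theorem DirectedAssignment.inAt_eq_inTo (f : N.DirectedAssignment) (v : V) :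
    f.inAt v = f.inTo {v} := by
  refine finsum_mem_congr (Set.ext fun e => ?_) fun _ _ => rfl
  have := f.init_ne_term e
  rw [Set.mem_ofPred_eq, Set.mem_ofPred_eq]
  rw [mem_boundary_iff f]
  simp only [Set.mem_singleton_iff]
  grind

theorem crossSum_singleton {G : V → V → ℤ} (hG : ∀ u v, G u v = -G v u)
    {v : V} (hfin : {u | G v u ≠ 0}.Finite) : crossSum G {v} = rowSum G v := by
  rw [crossSum_eq_finsum_rowSum hG, finsum_mem_singleton]
  refine (hfin.image fun u => (v, u)).subset ?_
  rintro ⟨a, b⟩ ⟨rfl, hp⟩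
  exact ⟨b, hp, rfl⟩

/-- A flow from an antisymmetric function on pairs of vertices. -/
theorem exists_flow_of_antisymm {s t : N.Point} {G : V → V → ℤ} (hG : ∀ u v, G u v = -G v u)
    (hle : ∀ u v, G u v ≤ N.pairCap u v) (hfin : ∀ u, {v | G u v ≠ 0}.Finite)
    (hcons : ∀ v : V, Sum.inl v ≠ s → Sum.inl v ≠ t →
      (∀ ω : N.End, Sum.inr ω = s ∨ Sum.inr ω = t → N.Separable (Sum.inl v) (Sum.inr ω)) →
      rowSum G v = 0)
    (hcut : ∀ A, N.IsCut A → ¬ N.Separates A s t → crossSum G A = 0) :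
    ∃ f : N.Flow s t, ∀ A, N.IsCut A → f.net A = crossSum G A := by
  have hdir : ∀ e : N.graph.edgeSet, ∃ d : N.graph.Dart, d.edge = e ∧ 0 ≤ G d.fst d.snd := by
    rintro ⟨e, he⟩
    obtain ⟨⟨a, b⟩, rfl⟩ := Quot.exists_rep e
    have hab : N.graph.Adj a b := he
    rcases le_total 0 (G a b) with h | h
    · exact ⟨⟨(a, b), hab⟩, rfl, h⟩
    · refine ⟨⟨(b, a), hab.symm⟩, Sym2.eq_swap, ?_⟩
      have := hG a b
      change 0 ≤ G b a
      omega
  choose dir hdir hpos using hdir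
  let f : N.DirectedAssignment := ⟨fun e => (G (dir e).fst (dir e).snd).toNat, dir, hdir⟩
  have hval : ∀ e, (f.val e : ℤ) = G (f.init e) (f.term e) := fun e => Int.toNat_of_nonneg (hpos e)
  have hedge : ∀ e : N.graph.edgeSet, (e : Sym2 V) = s(f.init e, f.term e) :=
    fun e => (hdir e).symm
  have hG0 : ∀ u v, ¬ N.graph.Adj u v → G u v = 0 := fun u v h => by
    have h1 := hG u v
    have h2 := hle u v
    have h3 := hle v u
    rw [pairCap_of_not_adj h] at h2
    rw [pairCap_of_not_adj fun h' => h h'.symm] at h3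
    omega
  have hnet : ∀ A, {e | e ∈ N.boundary A ∧ f.val e ≠ 0}.Finite → f.net A = crossSum G A := by
    classical
    intro A hA
    rw [f.net_eq_finsum (φ := fun e => if f.init e ∈ A then (f.val e : ℤ) else -f.val e) hA
      (fun e he => if_pos he) fun e he => if_neg he]
    refine finsum_boundary_eq_crossSum A _ G hG0 fun u hu v hv e he => ?_
    rw [hval]
    have h := (hedge e).symm.trans he
    rw [Sym2.eq_iff] at h
    rcases h with ⟨h1, h2⟩ | ⟨h1, h2⟩
    · rw [h1, h2, if_pos hu]
    · rw [h1, h2, if_neg hv, hG u v]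
  have hfinv : ∀ v : V, {e : N.graph.edgeSet | v ∈ (e : Sym2 V) ∧ f.val e ≠ 0}.Finite := by
    intro v
    refine Set.Finite.of_finite_image (f := Subtype.val)
      (((hfin v).image fun u => s(v, u)).subset ?_) Subtype.val_injective.injOn
    rintro _ ⟨e, ⟨he, he'⟩, rfl⟩
    have h0 := hval e
    rcases (f.mem_edge_iff e v).1 he with rfl | rfl
    · exact ⟨f.term e, fun h => he' (by omega), (hedge e).symm⟩
    · refine ⟨f.init e, fun h => he' ?_, Sym2.eq_swap.trans (hedge e).symm⟩
      rw [hG, h, neg_zero] at h0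
      exact_mod_cast h0
  refine ⟨⟨f, fun e => ?_, hfinv, fun v hs ht hω => ?_, fun A hA hsep => ?_⟩,
    fun A hA => hnet A (Set.Finite.subset hA fun e he => he.1)⟩
  · have h1 := hval e
    have h2 := hle (f.init e) (f.term e)
    have hadj : N.graph.Adj (f.init e) (f.term e) := (f.dir e).adj
    rw [pairCap_of_adj hadj] at h2
    have h3 : (⟨s(f.init e, f.term e), hadj⟩ : N.graph.edgeSet) = e :=
      Subtype.ext (hedge e).symm
    rw [h3] at h2
    omega
  · have h1 := hnet {v} ((hfinv v).subset fun e he => ⟨?_, he.2⟩)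
    · rw [crossSum_singleton hG (hfin v), hcons v hs ht hω, DirectedAssignment.net,
        ← f.outAt_eq_outOf, ← f.inAt_eq_inTo] at h1
      change f.outAt v = f.inAt v
      omega
    · rw [f.mem_edge_iff]
      rcases (mem_boundary_iff f _ e).1 he.1 with h | h
      · exact Or.inl h.1
      · exact Or.inr h.2
  · have h1 := hnet A (Set.Finite.subset hA fun e he => he.1)
    rw [hcut A hA hsep, DirectedAssignment.net] at h1
    change f.outOf A = f.inTo A
    omega

theorem crossSum_neg (g : V → V → ℤ) (B : Set V) :
    crossSum (fun u v => -g u v) B = -crossSum g B := by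
  rw [crossSum, crossSum, ← finsum_neg_distrib]
  simp only [← finsum_neg_distrib]

/-- Additivity of the net flow out of a set over the two parts of the set. -/
theorem crossSum_inter_add_crossSum_inter_compl {G : V → V → ℤ} (hG : ∀ u v, G u v = -G v u)
    (hle : ∀ u v, G u v ≤ N.pairCap u v) {A B : Set V} (hA : N.IsCut A) (hB : N.IsCut B) :
    crossSum G (B ∩ A) + crossSum G (B ∩ Aᶜ) = crossSum G B := by
  classical
  -- `G` may have infinite support. Only pairs in different cells of the partition generated by `A`
  -- and `B` matter, and finitely many of these are adjacent; for `G'` summation by parts applies.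
  let G' : V → V → ℤ := fun u v => if (u ∈ A ↔ v ∈ A) ∧ (u ∈ B ↔ v ∈ B) then 0 else G u v
  have hG' : ∀ u v, G' u v = -G' v u := fun u v => by
    simp only [G', @Iff.comm (v ∈ A), @Iff.comm (v ∈ B)]
    split_ifs
    · rfl
    · exact hG u v
  have hadj : ∀ u v, G u v ≠ 0 → N.pairCap u v ≠ 0 := fun u v h h0 => by
    have h1 := hG u v
    have h2 := hle u v
    have h3 := hle v u
    rw [pairCap_comm] at h3
    omega
  have hfin : {p : V × V | G' p.1 p.2 ≠ 0}.Finite := by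
    refine (((isCut_iff_finite_pairBoundary.1 hA).union
      (isCut_iff_finite_pairBoundary.1 hA.compl)).union
      ((isCut_iff_finite_pairBoundary.1 hB).union
      (isCut_iff_finite_pairBoundary.1 hB.compl))).subset fun p hp => ?_
    have hp' : ¬ ((p.1 ∈ A ↔ p.2 ∈ A) ∧ (p.1 ∈ B ↔ p.2 ∈ B)) := fun h => hp (if_pos h)
    have hc : N.pairCap p.1 p.2 ≠ 0 := hadj _ _ fun h => hp (by simp only [G', if_neg hp', h])
    simp only [pairBoundary, Set.mem_union, Set.mem_ofPred_eq, Set.mem_prod, Set.mem_compl_iff]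
    tauto
  have key : ∀ C : Set V, (∀ u v, (u ∈ A ↔ v ∈ A) → (u ∈ B ↔ v ∈ B) → (u ∈ C ↔ v ∈ C)) →
      crossSum G C = ∑ᶠ u ∈ C, rowSum G' u := by
    intro C hC
    rw [← crossSum_eq_finsum_rowSum hG' (hfin.subset fun p hp => hp.2)]
    exact crossSum_congr fun u hu v hv =>
      (if_neg fun h => hv ((hC u v h.1 h.2).1 hu)).symm
  have hrow : (Function.support (rowSum G')).Finite := by
    refine (hfin.image Prod.fst).subset fun u hu => ?_
    by_contra h
    exact hu (finsum_eq_zero_of_forall_eq_zero fun v => by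
      by_contra h'
      exact h ⟨(u, v), h', rfl⟩)
  rw [key B fun u v _ h => h, key (B ∩ A) fun u v h h' => and_congr h' h,
    key (B ∩ Aᶜ) fun u v h h' => and_congr h' (not_congr h)]
  exact finsum_mem_inter_add_sdiff' A (hrow.subset Set.inter_subset_right)

/-- A minimal cut is saturated by some flow. -/
theorem exists_flow_of_min_cut {s t : N.Point} {A : Set V} (hA : N.IsCut A) (hs : N.LiesIn A s)
    (ht : N.LiesIn Aᶜ t)
    (hmin : ∀ B, N.IsCut B → N.Separates B s t → N.cutCap A ≤ N.cutCap B) :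
    ∃ f : N.Flow s t, f.net A = N.cutCap A := by
  classical
  have hmA : N.IsMinCutAt s A := ⟨hA, hs, fun D hD hDA hDs =>
    hmin D hD (Or.inl ⟨hDs, ht.mono (Set.compl_subset_compl.2 hDA)⟩)⟩
  have hmB : N.IsMinCutAt t Aᶜ := ⟨hA.compl, ht, fun D hD hDA hDt => by
    rw [cutCap_compl]
    exact hmin D hD (Or.inr ⟨hs.mono (Set.subset_compl_comm.1 hDA), hDt⟩)⟩
  obtain ⟨P, hP⟩ := hmA.exists_halfFlow ht.nonempty
  obtain ⟨Q, hQ⟩ := hmB.exists_halfFlow (by rw [compl_compl]; exact hs.nonempty)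
  -- `P` runs towards `s`, so it is reversed. Across `A` both pieces equal the full capacity, which
  -- makes the definition consistent.
  let G : V → V → ℤ := fun u v => if u ∈ A then -P u v else Q u v
  have hGP : ∀ u ∈ A, ∀ v, G u v = -P u v := fun u hu v => if_pos hu
  have hGQ : ∀ u ∉ A, ∀ v, G u v = Q u v := fun u hu v => if_neg hu
  have hout : ∀ u ∈ A, ∀ v ∉ A, G u v = N.pairCap u v := fun u hu v hv => by
    rw [hGP u hu, hP.antisymm, neg_neg, hP.saturated v hv u hu, pairCap_comm]
  have hin : ∀ u ∈ A, ∀ v ∉ A, G v u = -N.pairCap u v := fun u hu v hv => by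
    rw [hGQ v hv, hQ.antisymm, hQ.saturated u (not_not.2 hu) v hv]
  have hanti : ∀ u v, G u v = -G v u := by
    intro u v
    by_cases hu : u ∈ A <;> by_cases hv : v ∈ A
    · rw [hGP u hu, hGP v hv, hP.antisymm]
    · rw [hout u hu v hv, hin u hu v hv, neg_neg]
    · rw [hout v hv u hu, hin v hv u hu]
    · rw [hGQ u hu, hGQ v hv, hQ.antisymm]
  have hle : ∀ u v, G u v ≤ N.pairCap u v := by
    intro u v
    by_cases hu : u ∈ A
    · rw [hGP u hu, ← hP.antisymm, pairCap_comm]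
      exact hP.le v u
    · rw [hGQ u hu]
      exact hQ.le u v
  -- Split `B` along `A`; each part is a cut on one side that excludes the terminal there, so the
  -- half flow has net zero across it. Cuts containing both terminals follow by taking complements.
  have hzero : ∀ B, N.IsCut B → N.LiesIn Bᶜ s → N.LiesIn Bᶜ t → crossSum G B = 0 := by
    intro B hB hBs hBt
    rw [← crossSum_inter_add_crossSum_inter_compl hanti hle hA hB]
    have h1 : crossSum G (B ∩ A) = -crossSum P (B ∩ A) := by
      rw [← crossSum_neg]
      exact crossSum_congr fun u hu v _ => hGP u hu.2 v
    have h2 : crossSum G (B ∩ Aᶜ) = crossSum Q (B ∩ Aᶜ) :=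
      crossSum_congr fun u hu v _ => hGQ u hu.2 v
    rw [h1, h2, hP.crossSum_eq_zero _ (hB.inter hA) Set.inter_subset_right
        (hBs.mono (Set.compl_subset_compl.2 Set.inter_subset_left)),
      hQ.crossSum_eq_zero _ (hB.inter hA.compl) Set.inter_subset_right
        (hBt.mono (Set.compl_subset_compl.2 Set.inter_subset_left)), neg_zero, add_zero]
  obtain ⟨f, hf⟩ := exists_flow_of_antisymm (s := s) (t := t) hanti hle (fun u => by
      by_cases hu : u ∈ A
      · refine (hP.finite u hu).subset fun v hv => ?_
        rw [Set.mem_ofPred_eq, hGP u hu, neg_ne_zero] at hv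
        exact hv
      · refine (hQ.finite u hu).subset fun v hv => ?_
        rw [Set.mem_ofPred_eq, hGQ u hu] at hv
        exact hv) (fun u hus hut hω => by
      by_cases hu : u ∈ A
      · have h1 := hP.conserved u hu hus fun ω h => hω ω (Or.inl h)
        have h2 : rowSum G u = -rowSum P u := by
          rw [rowSum, rowSum, ← finsum_neg_distrib]
          exact finsum_congr (hGP u hu)
        rw [h2, h1, neg_zero]
      · rw [← hQ.conserved u hu hut fun ω h => hω ω (Or.inr h)]
        exact finsum_congr (hGQ u hu)) (fun B hB hsep => by
      rcases hB.liesIn_or s with h1 | h1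
      · have h2 := (hB.liesIn_or t).resolve_right fun h => hsep (Or.inl ⟨h1, h⟩)
        have h3 := hzero Bᶜ hB.compl (by rwa [compl_compl]) (by rwa [compl_compl])
        rw [crossSum_compl hanti] at h3
        omega
      · exact hzero B hB h1 ((hB.liesIn_or t).resolve_left fun h => hsep (Or.inr ⟨h1, h⟩)))
  exact ⟨f, by rw [hf A hA, crossSum_congr hout, crossSum_pairCap hA]⟩

theorem Flow.net_le_cutCap {s t : N.Point} (f : N.Flow s t) {A : Set V} (hA : N.IsCut A) :
    f.net A ≤ N.cutCap A := by
  have h : f.outOf A ≤ N.cutCap A := by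
    have hA' : {e | e ∈ N.boundary A ∧ f.init e ∈ A}.Finite := Set.Finite.subset hA fun e he => he.1
    rw [DirectedAssignment.outOf, cutCap, finsum_mem_eq_finite_toFinset_sum _ hA',
      finsum_mem_eq_finite_toFinset_sum _ hA]
    refine (Finset.sum_le_sum fun e _ => f.le_cap e).trans (Finset.sum_le_sum_of_subset ?_)
    intro e he
    exact (Set.Finite.mem_toFinset hA).2 ((Set.Finite.mem_toFinset hA').1 he).1
  rw [DirectedAssignment.net]
  omega

theorem Separates.exists_oriented {s t : N.Point} {A : Set V} (hA : N.IsCut A)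
    (h : N.Separates A s t) :
    ∃ B, N.IsCut B ∧ N.LiesIn B s ∧ N.LiesIn Bᶜ t ∧ N.cutCap B = N.cutCap A := by
  rcases h with h | h
  · exact ⟨A, hA, h.1, h.2, rfl⟩
  · exact ⟨Aᶜ, hA.compl, h.1, by rw [compl_compl]; exact h.2, cutCap_compl N A⟩

end MaxFlowMinCut
end Network

theorem mainTheorem4 {V : Type u} (N : Network V) (s t : N.Point) (hst : N.Separable s t) :
    ∃ n : ℕ,
      IsLeast {k : ℕ | ∃ A : Set V, N.IsCut A ∧ N.Separates A s t ∧ N.cutCap A = k} n ∧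
      IsGreatest {k : ℤ | ∃ f : N.Flow s t, f.value = k} (n : ℤ) := by
  obtain ⟨A₀, hA₀, hsep₀⟩ := hst
  have hne : {k : ℕ | ∃ A : Set V, N.IsCut A ∧ N.Separates A s t ∧ N.cutCap A = k}.Nonempty :=
    ⟨_, A₀, hA₀, hsep₀, rfl⟩
  have hmem := Nat.sInf_mem hne
  refine ⟨_, ⟨hmem, fun k hk => Nat.sInf_le hk⟩, ?_⟩
  obtain ⟨A', hA', hsep', hcap'⟩ := hmem
  obtain ⟨A, hA, hs, ht, hcap⟩ := hsep'.exists_oriented hA'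
  rw [← hcap', ← hcap]
  refine ⟨?_, ?_⟩
  · obtain ⟨f, hf⟩ := Network.exists_flow_of_min_cut hA hs ht fun B hB hsep => by
      rw [hcap, hcap']
      exact Nat.sInf_le ⟨B, hB, hsep, rfl⟩
    exact ⟨f, (f.value_eq hA hs ht).trans hf⟩
  · rintro _ ⟨f, rfl⟩
    rw [f.value_eq hA hs ht]
    exact f.net_le_cutCap hA
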